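/- Let $E$ be a Polish space with Borel $\sigma$-field $\mathcal F$ and let $\mu$ be a $\sigma$-finite measure on $(E,\mathcal F)$. Let $\Gamma$ be the set of all at most countable sums $\gamma=\sum_i\delta_{x_i}$, $x_i\in E$ (the empty sum being the zero measure), with the $\sigma$-field $\mathcal F_\Gamma$ induced by the maps $\gamma\mapsto\gamma(A)$, $A\in\mathcal F$, and let $\pi_\mu$ be the Poisson measure with intensity $\mu$, i.e. the probability measure on $(\Gamma,\mathcal F_\Gamma)$ with $$\pi_\mu\big(\gamma(A_i)=k_i,\ 1\le i\le n\big)=\prod_{i=1}^n e^{-\mu(A_i)}\frac{\mu(A_i)^{k_i}}{k_i!}$$ for all disjoint $A_1,\dots,A_n\in\mathcal F$ with $\mu(A_i)<\infty$ and all $k_i\in\mathbb Z_+$. By a *full subspace* of $\Gamma$ we mean a set $S\in\mathcal F_\Gamma$ with $\pi_\mu(S)=1$, together with a topology on $S$ whose Borel $\sigma$-field is the trace of $\mathcal F_\Gamma$ on $S$. (a) There is a full subspace of $\Gamma$ that is a Polish space. (b) Let $\Gamma_0$ be any full subspace of $\Gamma$ that is a Polish space. Then there are compact sets $K_1\subset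 K_2\subset\cdots$ in $\Gamma_0$ with $\pi_\mu(K_n^c)\le 1/n$ for all $n\ge1$, and a topology on $\Gamma_\mu:=\bigcup_n K_n$, such that $\Gamma_\mu$ is a full subspace of $\Gamma$ and a locally compact separable metrizable space, every nonempty open subset of $\Gamma_\mu$ has positive $\pi_\mu$-measure, every $K_n$ is compact in $\Gamma_\mu$, and the inclusion $\Gamma_\mu\to\Gamma_0$ is continuous (so that $\Gamma_\mu$ and $\Gamma_0$ induce the same topology on every $K_n$). In particular $\Gamma_\mu$ is $\sigma$-compact. (c) Let $\psi:\Gamma\times E\to[0,\infty)$ be measurable with $\psi\in L^1(\pi_\mu\times\mu)$, and let $\Gamma_\mu$ be any full subspace of $\Gamma$ that is a locally compact separable metrizable space, for instance one as in (b). Put $$\mathcal E^\psi(F,G)=\int_{\Gamma\times E}\big(F(\gamma+\delta_z)-F(\gamma)\big)\big(G(\gamma+\delta_z)-G(\gamma)\big)\psi(\gamma,z)\,\pi_\mu(d\gamma)\mu(dz),$$ $$\mathcal D(\mathcal E^\psi)=\{F\in L^2(\Gamma_\mu;\pi_\mu):\ \mathcal E^\psi(F,F)<\infty\},$$ where functions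 on $\Gamma_\mu$ are extended to $\Gamma$ by $0$. Then $(\mathcal E^\psi,\mathcal D(\mathcal E^\psi))$ is a regular symmetric Dirichlet form on $L^2(\Gamma_\mu;\pi_\mu)$: it is a densely defined, closed, nonnegative definite, symmetric bilinear form; for $F\in\mathcal D(\mathcal E^\psi)$ and $\tilde F:=(F\vee0)\wedge1$ one has $\tilde F\in\mathcal D(\mathcal E^\psi)$ and $\mathcal E^\psi(\tilde F,\tilde F)\le\mathcal E^\psi(F,F)$; the measure $\pi_\mu$ is finite on the compact subsets of $\Gamma_\mu$; and the set of functions in $\mathcal D(\mathcal E^\psi)$ that are continuous with compact support on $\Gamma_\mu$ is dense in $\mathcal D(\mathcal E^\psi)$ for the norm $\big(\mathcal E^\psi(F,F)+\pi_\mu(F^2)\big)^{1/2}$, and uniformly dense in the set $C_0(\Gamma_\mu)$ of all continuous functions with compact support on $\Gamma_\mu$. -/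

import Mathlib

open MeasureTheory
open scoped ENNReal

namespace ConfigSpace

/-- The configuration space `Γ` over `E`: the at most countable sums of Dirac measures on `E`
(the empty sum being the zero measure, repetitions and accumulations of points being allowed).
As a subtype of `Measure E` it carries the σ-field induced by the evaluations `γ ↦ γ(A)`,
`A` measurable. -/
abbrev Config (E : Type*) [MeasurableSpace E] : Type _ :=
  {γ : Measure E // ∃ (ι : Type) (_ : Countable ι) (x : ι → E),
    γ = Measure.sum fun i => Measure.dirac (x i)}

/-- `π` is the Poisson measure with intensity `μ`: a probability measure on the configuration space
for which the numbers of points in disjoint sets `A₁, …, Aₙ` of finite `μ`-measure are independent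
Poisson variables with parameters `μ(A₁), …, μ(Aₙ)`. -/
structure IsPoissonMeasure {E : Type*} [MeasurableSpace E] (μ : Measure E)
    (π : Measure (Config E)) : Prop where
  isProbabilityMeasure : IsProbabilityMeasure π
  counts : ∀ (n : ℕ) (A : Fin n → Set E), (∀ i, MeasurableSet (A i)) →
    Pairwise (fun i j => Disjoint (A i) (A j)) → (∀ i, μ (A i) < ∞) → ∀ k : Fin n → ℕ,
      π {γ | ∀ i, γ.1 (A i) = (k i : ℝ≥0∞)} =
        ∏ i, ENNReal.ofReal
          (Real.exp (-(μ (A i)).toReal) * (μ (A i)).toReal ^ k i / (k i).factorial)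

/-! Existence of the Poisson measure: a countable superposition of independent finite samples. -/

section Existence

variable {E : Type*} [MeasurableSpace E]

/-- Finite samples of points of `E`. -/
abbrev Sample (E : Type*) : Type _ := Σ n : ℕ, (Fin n → E)

/-- The sample `x` of size `n`. -/
def mkSample (n : ℕ) (x : Fin n → E) : Sample E := ⟨n, x⟩

theorem measurableSet_sample {s : Set (Sample E)} :
    MeasurableSet s ↔ ∀ n, MeasurableSet (mkSample n ⁻¹' s) := by
  rw [MeasurableSpace.measurableSet_iInf]
  rfl

theorem measurable_mkSample (n : ℕ) : Measurable (mkSample (E := E) n) :=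
  fun _ hs => measurableSet_sample.1 hs n

theorem measurable_of_sample {X : Type*} [MeasurableSpace X] {f : Sample E → X}
    (h : ∀ n, Measurable fun x : Fin n → E => f (mkSample n x)) : Measurable f :=
  fun _ hs => measurableSet_sample.2 fun n => h n hs

/-- The law of a Poisson number of independent points, for a finite intensity `ν`. -/
noncomputable def sampleLaw (ν : Measure E) : Measure (Sample E) :=
  Measure.sum fun n => ENNReal.ofReal (Real.exp (-(ν Set.univ).toReal) / n.factorial) •
    (Measure.pi fun _ : Fin n => ν).map (mkSample n)

theorem sampleLaw_univ (ν : Measure E) [IsFiniteMeasure ν] : IsProbabilityMeasure (sampleLaw ν) := by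
  constructor
  rw [sampleLaw, Measure.sum_apply _ MeasurableSet.univ]
  set c := (ν Set.univ).toReal with hc
  have hc0 : 0 ≤ c := ENNReal.toReal_nonneg
  have h1 : ∀ n : ℕ, (ENNReal.ofReal (Real.exp (-c) / n.factorial) •
      (Measure.pi fun _ : Fin n => ν).map (mkSample n)) Set.univ =
      ENNReal.ofReal (Real.exp (-c) * (c ^ n / n.factorial)) := by
    intro n
    rw [Measure.smul_apply, Measure.map_apply (measurable_mkSample n) MeasurableSet.univ,
      Set.preimage_univ, Measure.pi_univ, Finset.prod_const, Finset.card_univ, Fintype.card_fin,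
      ← ENNReal.ofReal_toReal (measure_ne_top ν Set.univ), ← hc, ← ENNReal.ofReal_pow hc0,
      smul_eq_mul, ← ENNReal.ofReal_mul (by positivity)]
    congr 1; ring
  simp_rw [h1]
  have h2 := (NormedSpace.expSeries_div_hasSum_exp (𝔸 := ℝ) c).mul_left (Real.exp (-c))
  rw [← Real.exp_eq_exp_ℝ, ← Real.exp_add, neg_add_cancel, Real.exp_zero] at h2
  rw [← ENNReal.ofReal_tsum_of_nonneg (fun n => by positivity) h2.summable, h2.tsum_eq,
    ENNReal.ofReal_one]

theorem integral_sampleLaw (ν : Measure E) [IsFiniteMeasure ν] {h : E → ℂ} (hm : Measurable h)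
    (hb : ∀ x, ‖h x‖ ≤ 1) :
    ∫ ω, ∏ j, h (ω.2 j) ∂(sampleLaw ν) = Complex.exp (∫ x, (h x - 1) ∂ν) := by
  have hP := sampleLaw_univ ν
  have hmeas : Measurable fun ω : Sample E => ∏ j, h (ω.2 j) := by
    refine measurable_of_sample fun n => ?_
    change Measurable fun x : Fin n → E => ∏ j : Fin n, h (x j)
    exact Finset.measurable_fun_prod _ fun j _ => hm.comp (measurable_pi_apply j)
  have hint : Integrable (fun ω : Sample E => ∏ j, h (ω.2 j)) (sampleLaw ν) := by
    refine Integrable.of_bound hmeas.aestronglyMeasurable 1 (Filter.Eventually.of_forall fun ω => ?_)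
    rw [norm_prod]
    exact Finset.prod_le_one (fun _ _ => norm_nonneg _) (fun _ _ => hb _)
  have hs := hasSum_integral_measure hint
  have hint' : Integrable h ν :=
    Integrable.of_bound hm.aestronglyMeasurable 1 (Filter.Eventually.of_forall hb)
  set c := (ν Set.univ).toReal with hc
  set a := ∫ x, h x ∂ν with ha
  have h1 : ∀ n : ℕ, ∫ ω, ∏ j, h (ω.2 j) ∂(ENNReal.ofReal (Real.exp (-c) / n.factorial) •
      (Measure.pi fun _ : Fin n => ν).map (mkSample n)) =
      (Real.exp (-c) : ℂ) * (a ^ n / n.factorial) := by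
    intro n
    rw [integral_smul_measure, integral_map (measurable_mkSample n).aemeasurable
      hmeas.aestronglyMeasurable]
    have := integral_fintype_prod_eq_pow (ι := Fin n) (μ := ν) h
    simp only [Fintype.card_fin] at this
    change (ENNReal.ofReal (Real.exp (-c) / n.factorial)).toReal •
      (∫ x : Fin n → E, ∏ j, h (x j) ∂(Measure.pi fun _ : Fin n => ν)) = _
    rw [this, ← ha]
    rw [ENNReal.toReal_ofReal (by positivity), Complex.real_smul]
    push_cast; ring
  have h2 := (NormedSpace.expSeries_div_hasSum_exp (𝔸 := ℂ) a).mul_left (Real.exp (-c) : ℂ)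
  rw [← Complex.exp_eq_exp_ℂ, Complex.ofReal_exp, ← Complex.exp_add] at h2
  have h3 : ∫ x, (h x - 1) ∂ν = ((-c : ℝ) : ℂ) + a := by
    rw [integral_sub hint' (integrable_const _)]
    simp [Measure.real, ← hc, ← ha]
    ring
  rw [h3]
  refine hs.unique ?_
  rw [← Complex.ofReal_exp] at h2
  exact (funext h1 : _ = _) ▸ h2


open Classical in
/-- The number of points of a sample that lie in `A`. -/
noncomputable def count (A : Set E) (ω : Sample E) : ℕ := ∑ j, if ω.2 j ∈ A then 1 else 0

theorem measurable_count {A : Set E} (hA : MeasurableSet A) : Measurable (count A) := by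
  classical
  refine measurable_of_sample fun n => ?_
  change Measurable fun x : Fin n → E => ∑ j : Fin n, if x j ∈ A then 1 else 0
  exact Finset.measurable_fun_sum _ fun j _ =>
    Measurable.ite (measurable_pi_apply j hA) measurable_const measurable_const

/-- The numbers of points of a sample in finitely many sets. -/
noncomputable def countVec {m : ℕ} (A : Fin m → Set E) (ω : Sample E) :
    EuclideanSpace ℝ (Fin m) :=
  WithLp.toLp 2 fun i => (count (A i) ω : ℝ)

theorem measurable_countVec {m : ℕ} {A : Fin m → Set E} (hA : ∀ i, MeasurableSet (A i)) :
    Measurable (countVec A) := by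
  refine (MeasurableEquiv.toLp 2 (Fin m → ℝ)).measurable.comp (measurable_pi_lambda _ fun i => ?_)
  exact (measurable_from_top (f := fun n : ℕ => (n : ℝ))).comp (measurable_count (hA i))

theorem charFun_countVec (ν : Measure E) [IsFiniteMeasure ν] {m : ℕ} {A : Fin m → Set E}
    (hA : ∀ i, MeasurableSet (A i)) (hd : Pairwise fun i j => Disjoint (A i) (A j))
    (t : EuclideanSpace ℝ (Fin m)) :
    charFun ((sampleLaw ν).map (countVec A)) t =
      ∏ i, Complex.exp ((ν (A i)).toReal * (Complex.exp (t i * Complex.I) - 1)) := by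
  classical
  have hP := sampleLaw_univ ν
  set g : E → ℝ := fun x => ∑ i, if x ∈ A i then t i else 0 with hg
  have hgm : Measurable g := Finset.measurable_fun_sum _ fun i _ =>
    Measurable.ite (hA i) measurable_const measurable_const
  have key : ∀ ω : Sample E, Complex.exp (inner ℝ (countVec A ω) t * Complex.I) =
      ∏ j, Complex.exp (g (ω.2 j) * Complex.I) := by
    intro ω
    rw [← Complex.exp_sum, ← Finset.sum_mul, ← Complex.ofReal_sum]
    congr 3
    simp only [PiLp.inner_apply, countVec, count, hg, RCLike.inner_apply, conj_trivial]
    rw [Finset.sum_comm]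
    refine Finset.sum_congr rfl fun i _ => ?_
    push_cast
    rw [Finset.mul_sum]
    refine Finset.sum_congr rfl fun j _ => ?_
    split_ifs <;> simp
  rw [charFun_apply, integral_map (measurable_countVec hA).aemeasurable
    (by fun_prop)]
  simp_rw [key]
  rw [integral_sampleLaw ν (h := fun x => Complex.exp (g x * Complex.I)) (by fun_prop)
    (fun x => (Complex.norm_exp_ofReal_mul_I _).le), ← Complex.exp_sum]
  congr 1
  have h1 : ∀ x, Complex.exp (g x * Complex.I) - 1 =
      ∑ i, (A i).indicator (fun _ => Complex.exp (t i * Complex.I) - 1) x := by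
    intro x
    by_cases hx : ∃ i, x ∈ A i
    · obtain ⟨i, hi⟩ := hx
      have hne : ∀ j, j ≠ i → x ∉ A j := fun j hj hxj =>
        Set.disjoint_left.1 (hd hj) hxj hi
      have h2 : g x = t i := by
        rw [hg]
        simp only
        rw [Finset.sum_eq_single i (fun j _ hj => if_neg (hne j hj)) (by simp), if_pos hi]
      rw [h2, Finset.sum_eq_single i (fun j _ hj => Set.indicator_of_notMem (hne j hj) _) (by simp),
        Set.indicator_of_mem hi]
    · push Not at hx
      have h2 : g x = 0 := Finset.sum_eq_zero fun i _ => if_neg (hx i)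
      rw [h2, Finset.sum_eq_zero fun i _ => Set.indicator_of_notMem (hx i) _]
      simp
  simp_rw [h1]
  rw [integral_finsetSum _ fun i _ => (integrable_const _).indicator (hA i)]
  refine Finset.sum_congr rfl fun i _ => ?_
  rw [integral_indicator_const _ (hA i)]
  simp [Measure.real]

theorem partial_counts (ν : ℕ → Measure E) [∀ k, IsFiniteMeasure (ν k)] (K : ℕ)
    [∀ k, IsProbabilityMeasure (sampleLaw (ν k))] {m : ℕ} {A : Fin m → Set E}
    (hA : ∀ i, MeasurableSet (A i)) (hd : Pairwise fun i j => Disjoint (A i) (A j))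
    (n : Fin m → ℕ) :
    Measure.infinitePi (fun k => sampleLaw (ν k))
      {ω | ∀ i, ∑ k ∈ Finset.range K, count (A i) (ω k) = n i} =
      ∏ i, ENNReal.ofReal (Real.exp (-(∑ k ∈ Finset.range K, (ν k (A i)).toReal)) *
        (∑ k ∈ Finset.range K, (ν k (A i)).toReal) ^ n i / (n i).factorial) := by
  set P := Measure.infinitePi (fun k => sampleLaw (ν k)) with hP
  set r : Fin m → NNReal := fun i => ∑ k ∈ Finset.range K, (ν k (A i)).toNNReal with hr
  have hrc : ∀ i, (r i : ℝ) = ∑ k ∈ Finset.range K, (ν k (A i)).toReal := by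
    intro i
    rw [hr]; push_cast; rfl
  set V : ℕ → (ℕ → Sample E) → EuclideanSpace ℝ (Fin m) := fun k ω => countVec A (ω k) with hV
  have hVm : ∀ k, Measurable (V k) := fun k =>
    (measurable_countVec hA).comp (measurable_pi_apply k)
  set W : (ℕ → Sample E) → Fin m → ℝ :=
    fun ω i => ((∑ k ∈ Finset.range K, count (A i) (ω k) : ℕ) : ℝ) with hW
  have hWm : Measurable W := measurable_pi_lambda _ fun i =>
    (measurable_from_top (f := fun n : ℕ => (n : ℝ))).comp
      (Finset.measurable_fun_sum _ fun k _ => (measurable_count (hA i)).comp (measurable_pi_apply k))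
  have hWV : (fun ω => WithLp.toLp 2 (W ω)) = fun ω => ∑ k ∈ Finset.range K, V k ω := by
    ext ω i
    simp [hW, hV, countVec]
  have hind : ProbabilityTheory.iIndepFun V P :=
    ProbabilityTheory.iIndepFun_infinitePi (P := fun k => sampleLaw (ν k))
      (X := fun _ => countVec A) fun _ => measurable_countVec hA
  have hlaw : P.map W = Measure.pi fun i =>
      (ProbabilityTheory.poissonMeasure (r i)).map (Nat.cast : ℕ → ℝ) := by
    have : IsProbabilityMeasure (P.map W) := Measure.isProbabilityMeasure_map hWm.aemeasurable
    refine charFun_eq_pi_iff.1 fun t => ?_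
    rw [Measure.map_map (by fun_prop) hWm]
    change charFun (P.map fun ω => WithLp.toLp 2 (W ω)) t = _
    rw [hWV, ProbabilityTheory.iIndepFun.charFun_map_fun_finsetSum_eq_prod
      (fun k _ => (hVm k).aemeasurable) (ProbabilityTheory.iIndepFun.precomp (g := fun i : Finset.range K => (i : ℕ))
        Subtype.val_injective hind), Finset.prod_apply]
    have hk : ∀ k, charFun (P.map (V k)) t =
        ∏ i, Complex.exp ((ν k (A i)).toReal * (Complex.exp (t i * Complex.I) - 1)) := by
      intro k
      rw [← charFun_countVec (ν k) hA hd t]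
      congr 1
      have : V k = countVec A ∘ fun ω : ℕ → Sample E => ω k := rfl
      rw [this, ← Measure.map_map (measurable_countVec hA) (measurable_pi_apply k), hP,
        Measure.infinitePi_map_eval]
    simp_rw [hk]
    rw [Finset.prod_comm]
    refine Finset.prod_congr rfl fun i _ => ?_
    rw [ProbabilityTheory.charFun_map_cast_poissonMeasure, ← Complex.exp_sum, ← Finset.sum_mul]
    congr 2
    rw [← Complex.ofReal_sum, ← hrc]
  have hset : {ω : ℕ → Sample E | ∀ i, ∑ k ∈ Finset.range K, count (A i) (ω k) = n i} =
      W ⁻¹' (Set.univ.pi fun i => {(n i : ℝ)}) := by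
    ext ω
    simp only [hW, Set.mem_ofPred_eq, Set.mem_preimage, Set.mem_pi, Set.mem_univ, true_imp_iff,
      Set.mem_singleton_iff, Nat.cast_inj]
  rw [hset, ← Measure.map_apply hWm (MeasurableSet.univ_pi fun i => measurableSet_singleton _),
    hlaw, Measure.pi_pi]
  refine Finset.prod_congr rfl fun i _ => ?_
  rw [Measure.map_apply (by fun_prop) (measurableSet_singleton _)]
  have : (Nat.cast : ℕ → ℝ) ⁻¹' {(n i : ℝ)} = {n i} := by ext; simp
  rw [this, ProbabilityTheory.poissonMeasure_singleton, hrc]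

/-- The configuration made of all the points of a sequence of samples. -/
noncomputable def superpose (ω : ℕ → Sample E) : Config E :=
  ⟨Measure.sum fun p : (Σ k : ℕ, Fin (ω k).1) => Measure.dirac ((ω p.1).2 p.2),
    _, inferInstance, _, rfl⟩

theorem superpose_apply (ω : ℕ → Sample E) {A : Set E} (hA : MeasurableSet A) :
    (superpose ω).1 A = ∑' k, (count A (ω k) : ℝ≥0∞) := by
  classical
  rw [superpose, Measure.sum_apply _ hA, ENNReal.tsum_sigma'
    (fun p : (Σ k : ℕ, Fin (ω k).1) => Measure.dirac ((ω p.1).2 p.2) A)]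
  refine tsum_congr fun k => ?_
  rw [tsum_fintype, count]
  push_cast
  refine Finset.sum_congr rfl fun j _ => ?_
  rw [Measure.dirac_apply' _ hA]
  simp [Set.indicator_apply]

theorem measurable_superpose : Measurable (superpose (E := E)) := by
  refine Measurable.subtype_mk (Measure.measurable_of_measurable_coe _ fun A hA => ?_)
  change Measurable fun ω => (superpose ω).1 A
  simp_rw [superpose_apply _ hA]
  exact Measurable.tsum fun k => (measurable_from_top (f := fun n : ℕ => (n : ℝ≥0∞))).comp
    ((measurable_count hA).comp (measurable_pi_apply k))

theorem eventually_sum_eq_iff (a : ℕ → ℕ) (n : ℕ) :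
    ∀ᶠ K in Filter.atTop,
      (∑ k ∈ Finset.range K, a k = n ↔ ∑' k, (a k : ℝ≥0∞) = (n : ℝ≥0∞)) := by
  have hmono : Monotone fun K => ∑ k ∈ Finset.range K, a k := fun K L h =>
    Finset.sum_le_sum_of_subset (Finset.range_mono h)
  have hle : ∀ K, ((∑ k ∈ Finset.range K, a k : ℕ) : ℝ≥0∞) ≤ ∑' k, (a k : ℝ≥0∞) := by
    intro K
    push_cast
    exact ENNReal.sum_le_tsum _
  have hlim := ENNReal.tendsto_nat_tsum fun k => (a k : ℝ≥0∞)
  by_cases h : ∀ K, ∑ k ∈ Finset.range K, a k ≤ n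
  · by_cases h0 : ∃ K, ∑ k ∈ Finset.range K, a k = n
    · obtain ⟨K, hK⟩ := h0
      have hev : ∀ L ≥ K, ∑ k ∈ Finset.range L, a k = n := fun L hL =>
        le_antisymm (h L) (hK ▸ hmono hL)
      have ht : ∑' k, (a k : ℝ≥0∞) = (n : ℝ≥0∞) := by
        refine tendsto_nhds_unique hlim (tendsto_const_nhds.congr' ?_)
        filter_upwards [Filter.eventually_ge_atTop K] with L hL
        rw [← hev L hL]; push_cast; rfl
      filter_upwards [Filter.eventually_ge_atTop K] with L hL
      exact ⟨fun _ => ht, fun _ => hev L hL⟩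
    · push Not at h0
      refine Filter.Eventually.of_forall fun L => ⟨fun h' => absurd h' (h0 L), fun h' => ?_⟩
      exfalso
      have h1 : ∑' k, (a k : ℝ≥0∞) ≤ ((n - 1 : ℕ) : ℝ≥0∞) := by
        refine le_of_tendsto' hlim fun K => ?_
        have := h K; have := h0 K
        have h2 : ∑ k ∈ Finset.range K, a k ≤ n - 1 := by omega
        exact_mod_cast h2
      rw [h', Nat.cast_le] at h1
      have := h 0; have := h0 0
      simp at this
      omega
  · push Not at h
    obtain ⟨K, hK⟩ := h
    filter_upwards [Filter.eventually_ge_atTop K] with L hL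
    refine ⟨fun h' => absurd (h' ▸ hmono hL) (not_le.2 hK), fun h' => ?_⟩
    have := hle K
    rw [h', Nat.cast_le] at this
    omega

theorem exists_isPoissonMeasure (μ : Measure E) [SFinite μ] :
    ∃ π : Measure (Config E), IsPoissonMeasure μ π := by
  set ν := sfiniteSeq μ
  have hprob : ∀ k, IsProbabilityMeasure (sampleLaw (ν k)) := fun k => sampleLaw_univ (ν k)
  set P := Measure.infinitePi (fun k => sampleLaw (ν k)) with hP
  refine ⟨P.map superpose, Measure.isProbabilityMeasure_map measurable_superpose.aemeasurable, ?_⟩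
  intro m A hA hd hfin n
  have hev : ∀ B : Set E, MeasurableSet B → Measurable fun γ : Config E => γ.1 B := fun B hB =>
    (Measure.measurable_coe hB).comp measurable_subtype_coe
  have hSm : MeasurableSet {γ : Config E | ∀ i, γ.1 (A i) = (n i : ℝ≥0∞)} := by
    rw [Set.ofPred_forall]
    exact MeasurableSet.iInter fun i => hev _ (hA i) (measurableSet_singleton _)
  rw [Measure.map_apply measurable_superpose hSm]
  set S : ℕ → Set (ℕ → Sample E) :=
    fun K => {ω | ∀ i, ∑ k ∈ Finset.range K, count (A i) (ω k) = n i} with hS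
  have hSK : ∀ K, MeasurableSet (S K) := by
    intro K
    simp only [hS, Set.ofPred_forall]
    exact MeasurableSet.iInter fun i => (Finset.measurable_fun_sum (Finset.range K) fun k _ =>
      (measurable_count (hA i)).comp (measurable_pi_apply k)) (measurableSet_singleton _)
  have hlim : Filter.Tendsto (fun K => P (S K)) Filter.atTop
      (nhds (P (superpose ⁻¹' {γ : Config E | ∀ i, γ.1 (A i) = (n i : ℝ≥0∞)}))) := by
    refine tendsto_measure_of_tendsto_indicator Filter.atTop hSK MeasurableSet.univ
      (measure_ne_top _ _) (Filter.Eventually.of_forall fun _ => Set.subset_univ _) fun ω => ?_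
    simp only [hS, Set.mem_ofPred_eq, Set.mem_preimage, superpose_apply _ (hA _)]
    have := Filter.eventually_all.2 fun i => eventually_sum_eq_iff (fun k => count (A i) (ω k)) (n i)
    filter_upwards [this] with K hK
    exact forall_congr' hK
  refine tendsto_nhds_unique hlim ?_
  simp_rw [hS, hP, partial_counts ν _ hA hd n]
  rw [← ENNReal.ofReal_prod_of_nonneg fun i _ => by positivity]
  have hpos : ∀ K i, 0 ≤ Real.exp (-(∑ k ∈ Finset.range K, (ν k (A i)).toReal)) *
      (∑ k ∈ Finset.range K, (ν k (A i)).toReal) ^ n i / (n i).factorial := fun K i => by positivity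
  simp_rw [← ENNReal.ofReal_prod_of_nonneg fun i _ => hpos _ i]
  refine ENNReal.tendsto_ofReal (tendsto_finsetProd _ fun i _ => ?_)
  have hr : Filter.Tendsto (fun K => ∑ k ∈ Finset.range K, (ν k (A i)).toReal) Filter.atTop
      (nhds (μ (A i)).toReal) := by
    have h1 : μ (A i) = ∑' k, ν k (A i) := by
      conv_lhs => rw [← sum_sfiniteSeq μ]
      exact Measure.sum_apply _ (hA i)
    rw [h1]
    have h2 := (ENNReal.hasSum_toReal (h1 ▸ (hfin i).ne)).tendsto_sum_nat
    rwa [← ENNReal.tsum_toReal_eq fun k => measure_ne_top _ _] at h2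
  exact (((Real.continuous_exp.tendsto _).comp hr.neg).mul (hr.pow _)).div_const _

end Existence

section Form

variable {E : Type*} [MeasurableSpace E]

/-- The Poisson measure `π_μ` on the configuration space. -/
noncomputable def poissonMeasure (μ : Measure E) [SFinite μ] : Measure (Config E) :=
  (exists_isPoissonMeasure μ).choose

theorem isPoissonMeasure_poissonMeasure (μ : Measure E) [SFinite μ] :
    IsPoissonMeasure μ (poissonMeasure μ) :=
  (exists_isPoissonMeasure μ).choose_spec

/-- The configuration `γ + δ_z`. -/
noncomputable def addDirac (γ : Config E) (z : E) : Config E :=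
  ⟨γ.1 + Measure.dirac z, by
    obtain ⟨ι, _, x, hx⟩ := γ.2
    refine ⟨ι ⊕ Unit, inferInstance, Sum.elim x fun _ => z, ?_⟩
    ext A hA
    rw [hx, Measure.add_apply, Measure.sum_apply _ hA, Measure.sum_apply _ hA]
    rw [Summable.tsum_sum ENNReal.summable ENNReal.summable]
    simp⟩

/-- The difference operator `D_z F(γ) = F(γ + δ_z) - F(γ)`. -/
noncomputable def diff (F : Config E → ℝ) (p : Config E × E) : ℝ :=
  F (addDirac p.1 p.2) - F p.1

/-- The measure on a subset `S` of the configuration space induced by `π`. -/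
noncomputable def restr (π : Measure (Config E)) (S : Set (Config E)) : Measure S :=
  π.comap Subtype.val

/-- Functions on a subset `S` of the configuration space (of full measure below), extended
by `0`. -/
noncomputable def extendZero {S : Set (Config E)} (F : S → ℝ) : Config E → ℝ :=
  Function.extend Subtype.val F 0

/-- The form `E^ψ(F, G) = ∫ D_z F(γ) D_z G(γ) ψ(γ, z) π_μ(dγ) μ(dz)` for classes `F, G` in
`L²(S; π_μ)`, where `S` has full measure. As `γ + δ_z` avoids a given `π_μ`-null set for almost
every `(γ, z)`, the value does not depend on the versions of `F` and `G` or their extensions. -/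
noncomputable def birthForm (μ : Measure E) [SFinite μ] (ψ : Config E × E → ℝ)
    (S : Set (Config E)) (F G : Lp ℝ 2 (restr (poissonMeasure μ) S)) : ℝ :=
  ∫ p, diff (extendZero F) p * diff (extendZero G) p * ψ p ∂((poissonMeasure μ).prod μ)

/-- The domain of `E^ψ`: the classes `F` in `L²(S; π_μ)` with `E^ψ(F, F) < ∞`. -/
def birthDomain (μ : Measure E) [SFinite μ] (ψ : Config E × E → ℝ)
    (S : Set (Config E)) : Set (Lp ℝ 2 (restr (poissonMeasure μ) S)) :=
  {F | ∫⁻ p, ENNReal.ofReal (diff (extendZero F) p ^ 2 * ψ p) ∂((poissonMeasure μ).prod μ) < ∞}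

/-- `S`, with a topology of its own, is a measurable subset of full `π`-measure of the configuration
space whose Borel σ-field is the trace of the σ-field of the configuration space. -/
structure IsFullSubspace (π : Measure (Config E)) (S : Set (Config E)) [TopologicalSpace S] :
    Prop where
  measurableSet : MeasurableSet S
  measure_compl : π Sᶜ = 0
  borelSpace : BorelSpace S

end Form

section DirichletForm

variable {X : Type*} [MeasurableSpace X]

/-- `ℰ` with domain `D` is a symmetric Dirichlet form on `L²(m)`: a densely defined, closed,
nonnegative definite symmetric bilinear form on which the unit contraction operates. -/
structure IsDirichletForm (m : Measure X) (D : Set (Lp ℝ 2 m))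
    (ℰ : Lp ℝ 2 m → Lp ℝ 2 m → ℝ) : Prop where
  zero_mem : 0 ∈ D
  add_mem : ∀ u ∈ D, ∀ v ∈ D, u + v ∈ D
  smul_mem : ∀ (c : ℝ), ∀ u ∈ D, c • u ∈ D
  dense : Dense D
  add_left : ∀ u ∈ D, ∀ v ∈ D, ∀ w ∈ D, ℰ (u + v) w = ℰ u w + ℰ v w
  smul_left : ∀ (c : ℝ), ∀ u ∈ D, ∀ w ∈ D, ℰ (c • u) w = c * ℰ u w
  symm : ∀ u ∈ D, ∀ v ∈ D, ℰ u v = ℰ v u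
  nonneg : ∀ u ∈ D, 0 ≤ ℰ u u
  /-- `D` is complete for the norm `(ℰ(u, u) + ‖u‖²)^(1/2)`. -/
  closed : ∀ u : ℕ → Lp ℝ 2 m, (∀ n, u n ∈ D) →
    (∀ ε > 0, ∃ N, ∀ n ≥ N, ∀ k ≥ N, ℰ (u n - u k) (u n - u k) + ‖u n - u k‖ ^ 2 < ε) →
    ∃ v ∈ D, Filter.Tendsto (fun n => ℰ (u n - v) (u n - v) + ‖u n - v‖ ^ 2)
      Filter.atTop (nhds 0)
  markov : ∀ u ∈ D, ∃ v ∈ D, (v =ᵐ[m] fun x => min (max (u x) 0) 1) ∧ ℰ v v ≤ ℰ u u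

/-- A Dirichlet form on `L²(m)` is regular, `m` being a Radon measure on a locally compact separable
metrizable space `X`, if the continuous functions with compact support that belong to the domain
are dense in the domain for the norm `(ℰ(u, u) + ‖u‖²)^(1/2)` and uniformly dense in the continuous
functions with compact support. -/
structure IsRegularDirichletForm [TopologicalSpace X] [LocallyCompactSpace X]
    [TopologicalSpace.SeparableSpace X] [TopologicalSpace.MetrizableSpace X] [BorelSpace X]
    (m : Measure X) (D : Set (Lp ℝ 2 m)) (ℰ : Lp ℝ 2 m → Lp ℝ 2 m → ℝ) : Prop
    extends IsDirichletForm m D ℰ where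
  finite_on_compacts : ∀ K : Set X, IsCompact K → m K < ∞
  dense_domain : ∀ u ∈ D, ∀ ε > 0, ∃ v ∈ D,
    (∃ f : X → ℝ, Continuous f ∧ HasCompactSupport f ∧ v =ᵐ[m] f) ∧
    ℰ (u - v) (u - v) + ‖u - v‖ ^ 2 < ε
  dense_uniform : ∀ g : X → ℝ, Continuous g → HasCompactSupport g → ∀ ε > 0,
    ∃ f : X → ℝ, Continuous f ∧ HasCompactSupport f ∧ (∃ v ∈ D, v =ᵐ[m] f) ∧
      ∀ x, |f x - g x| < ε

end DirichletForm

end ConfigSpace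

/-! The form is controlled by one fact: for a given `π_μ`-null set, `γ + δ_z` avoids it for almost
every `(γ, z)`. This follows from the Mecke formula `IsPoissonMeasure.mecke`, which for `μ(B) < ∞`
identifies the image of `π_μ × μ|_B` under `(γ, z) ↦ γ + δ_z` as the measure with density `γ(B)`
with respect to `π_μ`; on counts in disjoint sets it is the recursion of the Poisson weights. Hence
`D_z F` is well defined on classes, and almost sure convergence of `F_n` passes to `D_z F_n`.
`IsDifference` retains only this.

With `ψ` absorbed into the measure, `ρ = ψ · (π_μ × μ)` is finite and the form is the squared
`L²(ρ)` norm of `D F`. Closedness follows by passing to almost surely convergent subsequences, the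
Markov property because truncation is 1-Lipschitz. As `ρ` is finite, bounded functions lie in the
domain, in particular all continuous functions with compact support. For density, truncation reduces
to a bounded `F`; this is an `L²` limit of continuous compactly supported functions with the same
bound, and dominated convergence along a subsequence handles the differences. The topology enters
only through its Borel sets and the density of these functions in `L²`.

For the locally compact space, inner regularity exhausts the measure by disjoint compact sets
(`exists_disjoint_compact_exhaustion`), and their union is given the disjoint-union topology
(`exists_topology_disjoint_union`). This refines the original topology but, having countably many
pieces, has the same Borel sets. Shrinking each piece to the support of its measure makes nonempty
open sets charged.

For the Polish space, `E` is partitioned into sets of finite `μ`-measure. Almost every configuration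
has finitely many points in each, so it is encoded uniquely by a sequence of finite samples, sorted
through an embedding of `E` into the reals. The Lusin–Souslin theorem makes this encoding an
isomorphism of measurable spaces (`standardBorelSpace_locallyFinite`). -/

namespace ConfigSpace

/-! ### The Mecke formula and null sets under adding a point. -/

section Mecke

variable {E : Type*} [MeasurableSpace E]

theorem measurable_eval {A : Set E} (hA : MeasurableSet A) :
    Measurable fun γ : Config E => γ.1 A :=
  (Measure.measurable_coe hA).comp measurable_subtype_coe

theorem addDirac_apply (γ : Config E) (z : E) (A : Set E) :
    (addDirac γ z).1 A = γ.1 A + Measure.dirac z A := rfl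

theorem measurable_addDirac : Measurable fun p : Config E × E => addDirac p.1 p.2 := by
  refine Measurable.subtype_mk (Measure.measurable_of_measurable_coe _ fun A hA => ?_)
  change Measurable fun p : Config E × E => p.1.1 A + Measure.dirac p.2 A
  exact ((measurable_eval hA).comp measurable_fst).add
    ((Measure.measurable_coe hA).comp (Measure.measurable_dirac.comp measurable_snd))

variable {μ : Measure E} {π : Measure (Config E)}

theorem IsPoissonMeasure.counts_fintype (h : IsPoissonMeasure μ π) {σ : Type*} [Fintype σ]
    {A : σ → Set E} (hA : ∀ i, MeasurableSet (A i))
    (hd : Pairwise fun i j => Disjoint (A i) (A j)) (hfin : ∀ i, μ (A i) < ∞) (k : σ → ℕ) :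
    π {γ | ∀ i, γ.1 (A i) = (k i : ℝ≥0∞)} =
      ∏ i, ENNReal.ofReal
        (Real.exp (-(μ (A i)).toReal) * (μ (A i)).toReal ^ k i / (k i).factorial) := by
  let e := Fintype.equivFin σ
  have := h.counts _ (fun i => A (e.symm i)) (fun i => hA _)
    (fun i j hij => hd (e.symm.injective.ne hij)) (fun i => hfin _) (fun i => k (e.symm i))
  rw [← Equiv.prod_comp e.symm, ← this]
  congr 1
  ext γ
  exact e.symm.forall_congr_right.symm

/-- The Poisson weights sum to one, so no mass is left for an infinite count. -/
theorem IsPoissonMeasure.ae_count (h : IsPoissonMeasure μ π) {A : Set E} (hA : MeasurableSet A)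
    (hfin : μ A < ∞) : ∀ᵐ γ ∂π, γ.1 A ∈ Set.range (Nat.cast : ℕ → ℝ≥0∞) := by
  have := h.isProbabilityMeasure
  have hm : ∀ k : ℕ, MeasurableSet {γ : Config E | γ.1 A = (k : ℝ≥0∞)} := fun k =>
    measurable_eval hA (measurableSet_singleton _)
  have hs : {γ : Config E | γ.1 A ∈ Set.range (Nat.cast : ℕ → ℝ≥0∞)} =
      ⋃ k : ℕ, {γ : Config E | γ.1 A = (k : ℝ≥0∞)} := by
    ext γ
    simp [eq_comm]
  have hms : MeasurableSet {γ : Config E | γ.1 A ∈ Set.range (Nat.cast : ℕ → ℝ≥0∞)} := by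
    rw [hs]; exact MeasurableSet.iUnion hm
  change {γ : Config E | γ.1 A ∈ Set.range (Nat.cast : ℕ → ℝ≥0∞)} ∈ ae π
  rw [mem_ae_iff_prob_eq_one hms, hs, measure_iUnion _ hm]
  · have h1 : ∀ k : ℕ, π {γ : Config E | γ.1 A = (k : ℝ≥0∞)} = ENNReal.ofReal
        (Real.exp (-(μ A).toReal) * ((μ A).toReal ^ k / k.factorial)) := by
      intro k
      have := h.counts_fintype (σ := Unit) (A := fun _ => A) (fun _ => hA)
        (fun i j hij => absurd rfl hij) (fun _ => hfin) (fun _ => k)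
      simpa [mul_div_assoc] using this
    simp_rw [h1]
    have h2 := (NormedSpace.expSeries_div_hasSum_exp (𝔸 := ℝ) (μ A).toReal).mul_left
      (Real.exp (-(μ A).toReal))
    rw [← Real.exp_eq_exp_ℝ, ← Real.exp_add, neg_add_cancel, Real.exp_zero] at h2
    rw [← ENNReal.ofReal_tsum_of_nonneg (fun n => by positivity) h2.summable, h2.tsum_eq,
      ENNReal.ofReal_one]
  · intro i j hij
    refine Set.disjoint_left.2 fun γ hi hj => hij ?_
    have : (i : ℝ≥0∞) = j := hi.symm.trans hj
    exact_mod_cast this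

/-- The recursion `a p(k - 1) = k p(k)` for the Poisson weights with parameter `a`. -/
theorem poisson_weight_succ {a : ℝ≥0∞} (ha : a < ∞) (k : ℕ) :
    a * ENNReal.ofReal (Real.exp (-a.toReal) * a.toReal ^ k / k.factorial) =
      (k + 1 : ℕ) * ENNReal.ofReal
        (Real.exp (-a.toReal) * a.toReal ^ (k + 1) / (k + 1).factorial) := by
  conv_lhs => rw [← ENNReal.ofReal_toReal ha.ne]
  rw [ENNReal.toReal_ofReal ENNReal.toReal_nonneg, ← ENNReal.ofReal_mul ENNReal.toReal_nonneg,
    ← ENNReal.ofReal_natCast, ← ENNReal.ofReal_mul (by positivity)]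
  congr 1
  rw [Nat.factorial_succ]
  push_cast
  field_simp
  ring

theorem measurableSet_counts {σ : Type*} [Countable σ] {D : σ → Set E}
    (hD : ∀ i, MeasurableSet (D i)) (k : σ → ℕ) :
    MeasurableSet {γ : Config E | ∀ s, γ.1 (D s) = (k s : ℝ≥0∞)} := by
  rw [Set.ofPred_forall]
  exact MeasurableSet.iInter fun i => measurable_eval (hD i) (measurableSet_singleton _)

/-- Both sides split over `j ∈ J`. A new point in `D j` raises only the `j`-th count, so the left
summand is `μ (D j)` times the probability of the counts `k` with `k j` lowered by one, and the
recursion of the Poisson weights turns it into `k j` times the probability of `k`. -/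
theorem IsPoissonMeasure.mecke_counts [SFinite μ] (h : IsPoissonMeasure μ π) {σ : Type*} [Fintype σ]
    {D : σ → Set E} (hD : ∀ i, MeasurableSet (D i))
    (hd : Pairwise fun i j => Disjoint (D i) (D j)) (hfin : ∀ i, μ (D i) < ∞) (J : Finset σ)
    (k : σ → ℕ) :
    π.prod (μ.restrict (⋃ j ∈ J, D j))
      ((fun p : Config E × E => addDirac p.1 p.2) ⁻¹' {γ | ∀ s, γ.1 (D s) = (k s : ℝ≥0∞)}) =
    ∫⁻ γ in {γ | ∀ s, γ.1 (D s) = (k s : ℝ≥0∞)}, γ.1 (⋃ j ∈ J, D j) ∂π := by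
  classical
  have := h.isProbabilityMeasure
  have hpd : (J : Set σ).PairwiseDisjoint D := fun i _ j _ hij => hd hij
  have hev := measurableSet_counts hD k
  have hright : ∫⁻ γ in {γ | ∀ s, γ.1 (D s) = (k s : ℝ≥0∞)}, γ.1 (⋃ j ∈ J, D j) ∂π =
      ∑ j ∈ J, (k j : ℝ≥0∞) * π {γ | ∀ s, γ.1 (D s) = (k s : ℝ≥0∞)} := by
    rw [← Finset.sum_mul, ← setLIntegral_const]
    refine setLIntegral_congr_fun hev fun γ hγ => ?_
    rw [measure_biUnion_finset hpd fun i _ => hD i]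
    exact Finset.sum_congr rfl fun i _ => hγ i
  rw [hright, Measure.prod_apply_symm (measurable_addDirac hev),
    lintegral_biUnion_finset hpd fun i _ => hD i]
  refine Finset.sum_congr rfl fun j _ => ?_
  have hdir : ∀ z ∈ D j, ∀ s, Measure.dirac z (D s) = if s = j then 1 else 0 := by
    intro z hz s
    rw [Measure.dirac_apply' _ (hD s)]
    split_ifs with hs
    · rw [hs]; exact Set.indicator_of_mem hz _
    · exact Set.indicator_of_notMem (fun hzs => Set.disjoint_left.1 (hd hs) hzs hz) _
  rcases hk : k j with _ | n
  -- After a point of `D j` has been added its count is at least one, so the event is empty.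
  · rw [Nat.cast_zero, zero_mul]
    refine (setLIntegral_congr_fun (g := fun _ => 0) (hD j) fun z hz => ?_).trans lintegral_zero
    refine measure_mono_null (t := ∅) (fun γ hγ => ?_) measure_empty
    have := hγ j
    rw [addDirac_apply, hdir z hz, if_pos rfl, hk] at this
    simp at this
  · have hset : ∀ z ∈ D j, (fun γ : Config E => (γ, z)) ⁻¹'
        ((fun p : Config E × E => addDirac p.1 p.2) ⁻¹' {γ | ∀ s, γ.1 (D s) = (k s : ℝ≥0∞)}) =
        {γ | ∀ s, γ.1 (D s) = (Function.update k j n s : ℝ≥0∞)} := by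
      intro z hz
      ext γ
      refine forall_congr' fun s => ?_
      rw [addDirac_apply, hdir z hz]
      by_cases hs : s = j
      · subst hs
        simp only [if_true, hk, Function.update_self, Nat.cast_succ]
        exact ENNReal.add_left_inj ENNReal.one_ne_top
      · simp [hs]
    rw [setLIntegral_congr_fun (hD j) fun z hz => congrArg π (hset z hz), setLIntegral_const,
      h.counts_fintype hD hd hfin, h.counts_fintype hD hd hfin,
      Fintype.prod_eq_mul_prod_compl j, Fintype.prod_eq_mul_prod_compl j, mul_comm, ← mul_assoc,
      ← mul_assoc, Function.update_self, poisson_weight_succ (hfin j), hk]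
    congr 1
    refine Finset.prod_congr rfl fun s hs => ?_
    rw [Function.update_of_ne (by simpa using hs)]

/-- Two measures on the configuration space, for which the numbers of points in the disjoint sets
`D s` are almost surely finite and have the same joint law. -/
theorem measure_counts_mem_eq {σ : Type*} [Finite σ] {D : σ → Set E}
    (hD : ∀ i, MeasurableSet (D i)) {m₁ m₂ : Measure (Config E)}
    (h₁ : ∀ s, ∀ᵐ γ ∂m₁, γ.1 (D s) ∈ Set.range (Nat.cast : ℕ → ℝ≥0∞))
    (h₂ : ∀ s, ∀ᵐ γ ∂m₂, γ.1 (D s) ∈ Set.range (Nat.cast : ℕ → ℝ≥0∞))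
    (heq : ∀ k : σ → ℕ, m₁ {γ | ∀ s, γ.1 (D s) = (k s : ℝ≥0∞)} =
      m₂ {γ | ∀ s, γ.1 (D s) = (k s : ℝ≥0∞)}) (M : Set (σ → ℝ≥0∞)) :
    m₁ {γ | (fun s => γ.1 (D s)) ∈ M} = m₂ {γ | (fun s => γ.1 (D s)) ∈ M} := by
  set I := {k : σ → ℕ | (fun s => (k s : ℝ≥0∞)) ∈ M} with hI
  have key : ∀ m : Measure (Config E),
      (∀ s, ∀ᵐ γ ∂m, γ.1 (D s) ∈ Set.range (Nat.cast : ℕ → ℝ≥0∞)) →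
      m {γ | (fun s => γ.1 (D s)) ∈ M} = ∑' k : I, m {γ | ∀ s, γ.1 (D s) = (k.1 s : ℝ≥0∞)} := by
    intro m hm
    rw [← measure_iUnion _ fun k : I => measurableSet_counts hD k.1]
    · refine measure_congr ?_
      filter_upwards [ae_all_iff.2 hm] with γ hγ
      choose k hk using hγ
      refine propext ⟨fun hM => Set.mem_iUnion.2 ⟨⟨k, ?_⟩, fun s => (hk s).symm⟩, fun hU => ?_⟩
      · change (fun s => γ.1 (D s)) ∈ M at hM
        simp only [hI, Set.mem_ofPred_eq, hk]
        exact hM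
      · obtain ⟨k', hk'⟩ := Set.mem_iUnion.1 hU
        have : (fun s => γ.1 (D s)) = fun s => (k'.1 s : ℝ≥0∞) := funext hk'
        change (fun s => γ.1 (D s)) ∈ M
        rw [this]
        exact k'.2
    · intro k k' hkk
      refine Set.disjoint_left.2 fun γ hi hj => hkk (Subtype.ext (funext fun s => ?_))
      have : (k.1 s : ℝ≥0∞) = k'.1 s := (hi s).symm.trans (hj s)
      exact_mod_cast this
  rw [key m₁ h₁, key m₂ h₂]
  exact tsum_congr fun k => heq k.1

/-- The points that lie in `A i` exactly for the indices `i ∈ s`. -/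
def atom {X ι : Type*} (A : ι → Set X) (s : Set ι) : Set X := {x | ∀ i, x ∈ A i ↔ i ∈ s}

theorem measurableSet_atom {ι : Type*} [Countable ι] {A : ι → Set E}
    (hA : ∀ i, MeasurableSet (A i)) (s : Set ι) : MeasurableSet (atom A s) := by
  rw [atom, Set.ofPred_forall]
  refine MeasurableSet.iInter fun i => ?_
  by_cases hi : i ∈ s
  · simp only [hi, iff_true]
    exact hA i
  · simp only [hi, iff_false]
    exact (hA i).compl

theorem disjoint_atom {X ι : Type*} (A : ι → Set X) {s t : Set ι} (hst : s ≠ t) :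
    Disjoint (atom A s) (atom A t) :=
  Set.disjoint_left.2 fun _ hs ht => hst (Set.ext fun i => (hs i).symm.trans (ht i))

theorem iUnion_atom {X ι : Type*} (A : ι → Set X) (i : ι) :
    ⋃ s : {s : Set ι // i ∈ s}, atom A s.1 = A i := by
  ext x
  simp only [Set.mem_iUnion]
  exact ⟨fun ⟨s, hs⟩ => (hs i).2 s.2, fun hx => ⟨⟨{j | x ∈ A j}, hx⟩, fun j => Iff.rfl⟩⟩

/-- The σ-field of the configuration space is generated by the numbers of points in the sets of
finite measure. -/
theorem measurableSpace_config_eq (μ : Measure E) [SigmaFinite μ] :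
    (inferInstance : MeasurableSpace (Config E)) =
      ⨆ A ∈ {A : Set E | MeasurableSet A ∧ μ A < ∞},
        MeasurableSpace.comap (fun γ : Config E => γ.1 A) inferInstance := by
  refine le_antisymm ?_ (iSup₂_le fun A hA => (measurable_eval hA.1).comap_le)
  set m' := ⨆ A ∈ {A : Set E | MeasurableSet A ∧ μ A < ∞},
        MeasurableSpace.comap (fun γ : Config E => γ.1 A) inferInstance with hm'
  have hfin : ∀ A : Set E, MeasurableSet A → μ A < ∞ →
      Measurable[m'] fun γ : Config E => γ.1 A := fun A hA hμ =>
    measurable_iff_comap_le.2 (le_iSup₂_of_le A ⟨hA, hμ⟩ le_rfl)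
  have hall : Measurable[m'] (Subtype.val : Config E → Measure E) := by
    refine @Measure.measurable_of_measurable_coe E (Config E) _ m' _ fun A hA => ?_
    -- By σ-finiteness, a count in an arbitrary `A` is a countable sum of counts in sets of finite
    -- measure.
    set B := disjointed (spanningSets μ) with hB
    have hBm : ∀ n, MeasurableSet (B n) := MeasurableSet.disjointed (measurableSet_spanningSets μ)
    have hsum : (fun γ : Config E => γ.1 A) = fun γ : Config E => ∑' n, γ.1 (A ∩ B n) := by
      ext γ
      rw [← measure_iUnion (fun i j hij => ((disjoint_disjointed _ hij).mono
        Set.inter_subset_right Set.inter_subset_right)) fun n => hA.inter (hBm n),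
        ← Set.inter_iUnion, iUnion_disjointed, iUnion_spanningSets, Set.inter_univ]
    rw [hsum]
    refine Measurable.tsum fun n => hfin _ (hA.inter (hBm n)) ?_
    exact (measure_mono (Set.inter_subset_right.trans (disjointed_subset _ _))).trans_lt
      (measure_spanningSets_lt_top μ n)
  exact measurable_iff_comap_le.1 hall

/-- The Mecke formula: adding to a Poisson configuration a point of a set `B` of finite measure
amounts to weighting the Poisson measure with the number of points in `B`. -/
theorem IsPoissonMeasure.mecke [SigmaFinite μ] (h : IsPoissonMeasure μ π) {B : Set E}
    (hB : MeasurableSet B) (hμB : μ B < ∞) :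
    (π.prod (μ.restrict B)).map (fun p : Config E × E => addDirac p.1 p.2) =
      π.withDensity fun γ => γ.1 B := by
  classical
  have := h.isProbabilityMeasure
  have : IsFiniteMeasure (μ.restrict B) := ⟨by simpa using hμB⟩
  set S := {A : Set E | MeasurableSet A ∧ μ A < ∞} with hS
  set m₁ := (π.prod (μ.restrict B)).map (fun p : Config E × E => addDirac p.1 p.2) with hm₁
  set m₂ := π.withDensity fun γ => γ.1 B with hm₂
  have hfin₂ : ∀ A ∈ S, ∀ᵐ γ ∂m₂, γ.1 A ∈ Set.range (Nat.cast : ℕ → ℝ≥0∞) := fun A hA =>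
    (withDensity_absolutelyContinuous _ _).ae_le (h.ae_count hA.1 hA.2)
  have hfin₁ : ∀ A ∈ S, ∀ᵐ γ ∂m₁, γ.1 A ∈ Set.range (Nat.cast : ℕ → ℝ≥0∞) := by
    intro A hA
    have hms : MeasurableSet {γ : Config E | γ.1 A ∈ Set.range (Nat.cast : ℕ → ℝ≥0∞)} :=
      measurable_eval hA.1 (Set.countable_range _).measurableSet
    refine (ae_map_iff measurable_addDirac.aemeasurable hms).2 ?_
    filter_upwards [Measure.quasiMeasurePreserving_fst.ae (h.ae_count hA.1 hA.2)] with p hp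
    obtain ⟨k, hk⟩ := hp
    rw [addDirac_apply, ← hk, Measure.dirac_apply' _ hA.1]
    by_cases hz : p.2 ∈ A
    · exact ⟨k + 1, by simp [hz]⟩
    · exact ⟨k, by simp [hz]⟩
  have main : ∀ s ∈ piiUnionInter (fun A : Set E => {s : Set (Config E) |
      MeasurableSet[MeasurableSpace.comap (fun γ : Config E => γ.1 A) inferInstance] s}) S,
      m₁ s = m₂ s := by
    rintro s ⟨t, htS, f, hf, rfl⟩
    choose! U hU using hf
    -- `B` is adjoined to the sets of the event as the index `none`, so that the density `γ(B)` is
    -- also a sum of counts over atoms.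
    set A : Option t → Set E := fun i => i.elim B fun a => a.1 with hA
    have hAS : ∀ i, A i ∈ S := by
      rintro (_ | a)
      · exact ⟨hB, hμB⟩
      · exact htS a.2
    -- The atom of the empty index set, the complement of all the `A i`, may have infinite measure;
    -- it is not needed.
    let σ := {s : Set (Option t) // s.Nonempty}
    let D : σ → Set E := fun s => atom A s.1
    have hDm : ∀ s, MeasurableSet (D s) := fun s => measurableSet_atom (fun i => (hAS i).1) s.1
    have hDd : Pairwise fun s s' => Disjoint (D s) (D s') := fun s s' hss =>
      disjoint_atom A fun hh => hss (Subtype.ext hh)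
    have hDA : ∀ i, A i = ⋃ s ∈ Finset.univ.filter (fun s : σ => i ∈ s.1), D s := by
      intro i
      rw [← iUnion_atom A i]
      ext x
      simp only [Set.mem_iUnion, Finset.mem_filter, Finset.mem_univ, true_and, exists_prop]
      exact ⟨fun ⟨s, hs⟩ => ⟨⟨s.1, i, s.2⟩, s.2, hs⟩, fun ⟨s, hi, hs⟩ => ⟨⟨s.1, hi⟩, hs⟩⟩
    have hDS : ∀ s, D s ∈ S := by
      intro s
      obtain ⟨i, hi⟩ := s.2
      exact ⟨hDm s, (measure_mono fun x hx => (hx i).2 hi).trans_lt (hAS i).2⟩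
    have hsum : ∀ (γ : Config E) i, γ.1 (A i) =
        ∑ s ∈ Finset.univ.filter (fun s : σ => i ∈ s.1), γ.1 (D s) := by
      intro γ i
      conv_lhs => rw [hDA i]
      exact measure_biUnion_finset (fun s _ s' _ hss => hDd hss) fun s _ => hDm s
    have hev : ⋂ x ∈ t, f x = {γ : Config E | (fun s => γ.1 (D s)) ∈
        {v : σ → ℝ≥0∞ | ∀ a : t, ∑ s ∈ Finset.univ.filter (fun s : σ => some a ∈ s.1), v s ∈
          U a.1}} := by
      ext γ
      simp only [Set.mem_iInter, Set.mem_ofPred_eq, ← hsum, Subtype.forall]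
      refine forall₂_congr fun a ha => ?_
      rw [← (hU a ha).2]
      rfl
    rw [hev]
    refine measure_counts_mem_eq hDm (fun s => hfin₁ _ (hDS s)) (fun s => hfin₂ _ (hDS s))
      (fun k => ?_) _
    have hBD : B = ⋃ s ∈ Finset.univ.filter (fun s : σ => none ∈ s.1), D s := hDA none
    have hev' := measurableSet_counts hDm k
    rw [hm₁, hm₂, Measure.map_apply measurable_addDirac hev', withDensity_apply _ hev', hBD]
    exact h.mecke_counts hDm hDd (fun s => (hDS s).2) _ k
  refine ext_of_generate_finite _ ?_ (isPiSystem_piiUnionInter _ (fun A => ?_) S) main ?_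
  · exact (measurableSpace_config_eq μ).trans (generateFrom_piiUnionInter_measurableSet
      (fun A : Set E => MeasurableSpace.comap (fun γ : Config E => γ.1 A) inferInstance) S).symm
  · exact @MeasurableSpace.isPiSystem_measurableSet _
      (MeasurableSpace.comap (fun γ : Config E => γ.1 A) inferInstance)
  -- Equality of the total masses is the case of an empty family of constraints.
  · exact main _ ⟨∅, by simp, fun _ => Set.univ, by simp, by simp⟩

/-- For a null set `N` of the Poisson measure, `γ + δ_z ∉ N` for almost every `(γ, z)`. -/
theorem IsPoissonMeasure.quasiMeasurePreserving_addDirac [SigmaFinite μ]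
    (h : IsPoissonMeasure μ π) :
    Measure.QuasiMeasurePreserving (fun p : Config E × E => addDirac p.1 p.2) (π.prod μ) π := by
  have := h.isProbabilityMeasure
  refine ⟨measurable_addDirac, Measure.AbsolutelyContinuous.mk fun N hN h0 => ?_⟩
  have hpre := measurable_addDirac hN
  rw [Measure.map_apply measurable_addDirac hN]
  have hn : ∀ n, π.prod (μ.restrict (spanningSets μ n))
      ((fun p : Config E × E => addDirac p.1 p.2) ⁻¹' N) = 0 := by
    intro n
    rw [← Measure.map_apply measurable_addDirac hN,
      h.mecke (measurableSet_spanningSets μ n) (measure_spanningSets_lt_top μ n)]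
    exact withDensity_absolutelyContinuous _ _ h0
  rw [Measure.prod_apply_symm hpre, ← setLIntegral_univ, ← iUnion_spanningSets μ]
  refine le_antisymm ((lintegral_iUnion_le _ _).trans ?_) zero_le
  simp_rw [← Measure.prod_apply_symm hpre, hn]
  simp

end Mecke

/-! ### Dirichlet forms of abstract difference operators. -/

section DifferenceForm

open Filter Topology

variable {X Y : Type*} [MeasurableSpace X] [MeasurableSpace Y]

/-- `D` is a difference operator: `D F (y)` is the difference of the values of `F` at two points
which depend on `y` only and almost surely avoid any given null set. -/
structure IsDifference (m : Measure X) (ρ : Measure Y) (D : (X → ℝ) → Y → ℝ) : Prop where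
  measurable : ∀ F, Measurable F → Measurable (D F)
  ae : ∀ P : X → Prop, (∀ᵐ x ∂m, P x) →
    ∀ᵐ y ∂ρ, ∃ a b, P a ∧ P b ∧ ∀ F, D F y = F a - F b

/-- The classes with square integrable differences. -/
def differenceDomain (m : Measure X) (ρ : Measure Y) (D : (X → ℝ) → Y → ℝ) : Set (Lp ℝ 2 m) :=
  {F | MemLp (D F) 2 ρ}

/-- The form `∫ D F D G dρ`. -/
noncomputable def differenceForm (m : Measure X) (ρ : Measure Y) (D : (X → ℝ) → Y → ℝ)
    (F G : Lp ℝ 2 m) : ℝ :=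
  ∫ y, D F y * D G y ∂ρ

theorem integral_mul_self_eq_norm_sq {ρ : Measure Y} {f : Y → ℝ} (w : Lp ℝ 2 ρ) (h : w =ᵐ[ρ] f) :
    ∫ y, f y * f y ∂ρ = ‖w‖ ^ 2 := by
  rw [← real_inner_self_eq_norm_sq, L2.inner_def]
  refine integral_congr_ae ?_
  filter_upwards [h] with y hy
  simp [hy, sq]

theorem tendsto_integral_mul_self_zero {ρ : Measure Y} {f : ℕ → Y → ℝ} {g : Y → ℝ}
    (hg : MemLp g 2 ρ) (hf : ∀ n, AEStronglyMeasurable (f n) ρ)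
    (hfg : ∀ n, ∀ᵐ y ∂ρ, |f n y| ≤ g y) (h0 : ∀ᵐ y ∂ρ, Tendsto (fun n => f n y) atTop (𝓝 0)) :
    Tendsto (fun n => ∫ y, f n y * f n y ∂ρ) atTop (𝓝 0) := by
  have := tendsto_integral_of_dominated_convergence (μ := ρ) (F := fun n y => f n y * f n y)
    (f := fun _ => 0) (fun y => g y ^ 2) (fun n => (hf n).mul (hf n)) hg.integrable_sq
    (fun n => by
      filter_upwards [hfg n] with y hy
      rw [Real.norm_eq_abs, abs_mul, ← sq]
      gcongr)
    (by
      filter_upwards [h0] with y hy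
      simpa using hy.mul hy)
  simpa using this

theorem abs_clip_sub_le (c d a b : ℝ) :
    |min (max a c) d - min (max b c) d| ≤ |a - b| := by
  refine (abs_min_sub_min_le_max _ _ _ _).trans ?_
  simp only [sub_self, abs_zero]
  refine max_le ((abs_max_sub_max_le_max _ _ _ _).trans ?_) (abs_nonneg _)
  simp

theorem exists_continuous_approx_Lp [TopologicalSpace X] [LocallyCompactSpace X]
    [TopologicalSpace.SeparableSpace X] [TopologicalSpace.MetrizableSpace X] [BorelSpace X]
    (m : Measure X) [IsFiniteMeasure m]
    (u : Lp ℝ 2 m) {ε : ℝ} (hε : 0 < ε) :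
    ∃ f : X → ℝ, Continuous f ∧ HasCompactSupport f ∧ ∃ hf : MemLp f 2 m, ‖u - hf.toLp‖ < ε := by
  let _ := TopologicalSpace.metrizableSpaceMetric X
  have : SecondCountableTopology X := UniformSpace.secondCountable_of_separable X
  obtain ⟨g, hgc, hg, hgcont, hgm⟩ := (Lp.memLp u).exists_hasCompactSupport_eLpNorm_sub_le
    ENNReal.ofNat_ne_top (ε := ENNReal.ofReal (ε / 2)) (by simpa using hε)
  refine ⟨g, hgcont, hgc, hgm, ?_⟩
  have h1 : ‖u - hgm.toLp‖ = (eLpNorm (⇑u - g) 2 m).toReal := by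
    rw [Lp.norm_def]
    congr 1
    refine eLpNorm_congr_ae ?_
    filter_upwards [Lp.coeFn_sub u hgm.toLp, hgm.coeFn_toLp] with x h1 h2
    rw [h1, Pi.sub_apply, Pi.sub_apply, h2]
  rw [h1]
  refine (ENNReal.toReal_mono ENNReal.ofReal_ne_top hg).trans_lt ?_
  rw [ENNReal.toReal_ofReal (by positivity)]
  linarith

variable {m : Measure X} {ρ : Measure Y} {D : (X → ℝ) → Y → ℝ}

namespace IsDifference

theorem measurable_coe (h : IsDifference m ρ D) (u : Lp ℝ 2 m) : Measurable (D u) :=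
  h.measurable _ (Lp.stronglyMeasurable u).measurable

theorem ae_sub (h : IsDifference m ρ D) (u v : Lp ℝ 2 m) :
    D (u - v : Lp ℝ 2 m) =ᵐ[ρ] D u - D v := by
  filter_upwards [h.ae _ (Lp.coeFn_sub u v)] with y ⟨a, b, ha, hb, hF⟩
  simp only [Pi.sub_apply, hF, ha, hb]
  ring

theorem ae_add (h : IsDifference m ρ D) (u v : Lp ℝ 2 m) :
    D (u + v : Lp ℝ 2 m) =ᵐ[ρ] D u + D v := by
  filter_upwards [h.ae _ (Lp.coeFn_add u v)] with y ⟨a, b, ha, hb, hF⟩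
  simp only [Pi.add_apply, hF, ha, hb]
  ring

theorem ae_smul (h : IsDifference m ρ D) (c : ℝ) (u : Lp ℝ 2 m) :
    D (c • u : Lp ℝ 2 m) =ᵐ[ρ] c • D u := by
  filter_upwards [h.ae _ (Lp.coeFn_smul c u)] with y ⟨a, b, ha, hb, hF⟩
  simp only [Pi.smul_apply, hF, ha, hb, smul_eq_mul]
  ring

/-- Expresses the form through the `L²(ρ)` norm, which makes completeness and the triangle
inequality available. -/
theorem form_sub (h : IsDifference m ρ D) {u v : Lp ℝ 2 m} (hu : MemLp (D u) 2 ρ)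
    (hv : MemLp (D v) 2 ρ) :
    differenceForm m ρ D (u - v) (u - v) = ‖hu.toLp - hv.toLp‖ ^ 2 := by
  refine integral_mul_self_eq_norm_sq _ ?_
  filter_upwards [h.ae_sub u v, Lp.coeFn_sub hu.toLp hv.toLp, hu.coeFn_toLp, hv.coeFn_toLp]
    with y h1 h2 h3 h4
  rw [h1, h2, Pi.sub_apply, Pi.sub_apply, h3, h4]

theorem form_sub_le (h : IsDifference m ρ D) {u v w : Lp ℝ 2 m}
    (hu : u ∈ differenceDomain m ρ D) (hv : v ∈ differenceDomain m ρ D)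
    (hw : w ∈ differenceDomain m ρ D) :
    differenceForm m ρ D (u - w) (u - w) + ‖u - w‖ ^ 2 ≤
      2 * (differenceForm m ρ D (u - v) (u - v) + ‖u - v‖ ^ 2) +
      2 * (differenceForm m ρ D (v - w) (v - w) + ‖v - w‖ ^ 2) := by
  have hu' : MemLp (D u) 2 ρ := hu
  have hv' : MemLp (D v) 2 ρ := hv
  have hw' : MemLp (D w) 2 ρ := hw
  rw [h.form_sub hu' hw', h.form_sub hu' hv', h.form_sub hv' hw']
  have key : ∀ p q r : ℝ, 0 ≤ p → p ≤ q + r → p ^ 2 ≤ 2 * q ^ 2 + 2 * r ^ 2 := by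
    intro p q r hp hpq
    nlinarith [sq_nonneg (q - r)]
  have h1 := key _ _ _ (norm_nonneg _) (norm_sub_le_norm_sub_add_norm_sub u v w)
  have h2 := key _ _ _ (norm_nonneg _)
    (norm_sub_le_norm_sub_add_norm_sub hu'.toLp hv'.toLp hw'.toLp)
  linarith

/-- A difference of two values bounded by `M` is at most `2M`, and constants are square integrable
for a finite `ρ`. -/
theorem mem_of_bound [IsFiniteMeasure ρ] (h : IsDifference m ρ D) {u : Lp ℝ 2 m} {M : ℝ}
    (hM : ∀ᵐ x ∂m, |u x| ≤ M) : u ∈ differenceDomain m ρ D := by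
  refine MemLp.of_bound (h.measurable_coe u).aestronglyMeasurable (M + M) ?_
  filter_upwards [h.ae _ hM] with y ⟨a, b, ha, hb, hF⟩
  rw [hF, Real.norm_eq_abs]
  exact (abs_sub _ _).trans (add_le_add ha hb)

/-- Truncation is 1-Lipschitz, so differences shrink pointwise; `c ≤ 0 ≤ d` makes it fix `0`, hence
preserve `L²(m)`. The choice `c = 0`, `d = 1` gives the Markov property, `c = -n`, `d = n` the
bounded approximation. -/
theorem exists_clip (h : IsDifference m ρ D) {u : Lp ℝ 2 m} (hu : u ∈ differenceDomain m ρ D)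
    {c d : ℝ} (hc : c ≤ 0) (hd : 0 ≤ d) :
    ∃ v ∈ differenceDomain m ρ D, (v =ᵐ[m] fun x => min (max (u x) c) d) ∧
      ∀ᵐ y ∂ρ, |D v y| ≤ |D u y| := by
  have hm : MemLp (fun x => min (max (u x) c) d) 2 m := by
    refine (Lp.memLp u).mono ?_ (Eventually.of_forall fun x => ?_)
    · exact (((Lp.stronglyMeasurable u).measurable.max measurable_const).min
        measurable_const).aestronglyMeasurable
    · have := abs_clip_sub_le c d (u x) 0
      rwa [max_eq_left hc, min_eq_left hd, sub_zero, sub_zero] at this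
  have hD : ∀ᵐ y ∂ρ, |D hm.toLp y| ≤ |D u y| := by
    filter_upwards [h.ae _ hm.coeFn_toLp] with y ⟨a, b, ha, hb, hF⟩
    rw [hF, hF, ha, hb]
    exact abs_clip_sub_le _ _ _ _
  exact ⟨hm.toLp, MemLp.mono hu (h.measurable_coe _).aestronglyMeasurable hD, hm.coeFn_toLp, hD⟩

/-- Truncations at level `n` converge pointwise to `u`, and `2 |D u|` dominates the differences of
the errors, so dominated convergence applies without finiteness of `ρ`. -/
theorem exists_bounded_approx (h : IsDifference m ρ D) {u : Lp ℝ 2 m}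
    (hu : u ∈ differenceDomain m ρ D) {ε : ℝ} (hε : 0 < ε) :
    ∃ v ∈ differenceDomain m ρ D, (∃ M : ℝ, ∀ᵐ x ∂m, |v x| ≤ M) ∧
      differenceForm m ρ D (u - v) (u - v) + ‖u - v‖ ^ 2 < ε := by
  choose v hv hvu hDv using fun n : ℕ =>
    h.exists_clip hu (c := -(n : ℝ)) (d := n) (by simp) (by simp)
  have hlim : ∀ t : ℝ, Tendsto (fun n : ℕ => min (max t (-(n : ℝ))) n) atTop (𝓝 t) := by
    intro t
    refine tendsto_const_nhds.congr' ?_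
    filter_upwards [eventually_ge_atTop ⌈|t|⌉₊] with n hn
    have : |t| ≤ n := (Nat.le_ceil _).trans (by exact_mod_cast hn)
    rw [max_eq_left (abs_le.1 this).1, min_eq_left (abs_le.1 this).2]
  have h1 : Tendsto (fun n => differenceForm m ρ D (u - v n) (u - v n)) atTop (𝓝 0) := by
    refine tendsto_integral_mul_self_zero (g := fun y => |D u y| + |D u y|)
      (MemLp.add (MemLp.abs hu) (MemLp.abs hu))
      (fun n => (h.measurable_coe _).aestronglyMeasurable) (fun n => ?_) ?_
    · filter_upwards [h.ae_sub u (v n), hDv n] with y h1 h2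
      rw [h1, Pi.sub_apply]
      exact (abs_sub _ _).trans (add_le_add le_rfl h2)
    · filter_upwards [h.ae _ (ae_all_iff.2 hvu), ae_all_iff.2 fun n => h.ae_sub u (v n)]
        with y ⟨a, b, ha, hb, hF⟩ h1
      simp only [h1, Pi.sub_apply, hF, ha, hb]
      have := (tendsto_const_nhds (x := u a - u b)).sub ((hlim (u a)).sub (hlim (u b)))
      rwa [sub_self] at this
  have h2 : Tendsto (fun n => ‖u - v n‖ ^ 2) atTop (𝓝 0) := by
    simp_rw [← integral_mul_self_eq_norm_sq _ (Filter.EventuallyEq.refl _ _)]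
    refine tendsto_integral_mul_self_zero (g := fun x => |u x| + |u x|)
      ((Lp.memLp u).abs.add (Lp.memLp u).abs)
      (fun n => (Lp.stronglyMeasurable _).aestronglyMeasurable) (fun n => ?_) ?_
    · filter_upwards [Lp.coeFn_sub u (v n), hvu n] with x h1 h2
      rw [h1, Pi.sub_apply, h2]
      have hn : (0 : ℝ) ≤ n := Nat.cast_nonneg n
      have := abs_clip_sub_le (-(n : ℝ)) n (u x) 0
      rw [max_eq_left (neg_nonpos.2 hn), min_eq_left hn, sub_zero, sub_zero] at this
      exact (abs_sub _ _).trans (add_le_add le_rfl this)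
    · filter_upwards [ae_all_iff.2 fun n => Lp.coeFn_sub u (v n), ae_all_iff.2 hvu] with x h1 h2
      simp only [h1, Pi.sub_apply, h2]
      have := (tendsto_const_nhds (x := u x)).sub (hlim (u x))
      rwa [sub_self] at this
  have h3 := h1.add h2
  rw [add_zero] at h3
  obtain ⟨n, hn⟩ := (h3.eventually_lt_const hε).exists
  refine ⟨v n, hv n, ⟨n, ?_⟩, hn⟩
  filter_upwards [hvu n] with x hx
  rw [hx, abs_le]
  exact ⟨le_min (le_max_right _ _) (by linarith [(Nat.cast_nonneg n : (0 : ℝ) ≤ n)]), min_le_right _ _⟩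

/-- A Cauchy sequence converges to some `v` in `L²(m)`, while its differences converge to some `z`
in `L²(ρ)`. Since almost sure convergence passes to differences, `z = D v`. -/
theorem closed (h : IsDifference m ρ D) (u : ℕ → Lp ℝ 2 m)
    (hu : ∀ n, u n ∈ differenceDomain m ρ D)
    (hc : ∀ ε > 0, ∃ N, ∀ n ≥ N, ∀ k ≥ N,
      differenceForm m ρ D (u n - u k) (u n - u k) + ‖u n - u k‖ ^ 2 < ε) :
    ∃ v ∈ differenceDomain m ρ D, Tendsto
      (fun n => differenceForm m ρ D (u n - v) (u n - v) + ‖u n - v‖ ^ 2) atTop (𝓝 0) := by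
  have hu' : ∀ n, MemLp (D (u n)) 2 ρ := hu
  set w : ℕ → Lp ℝ 2 ρ := fun n => (hu' n).toLp with hw
  have hform : ∀ n k, differenceForm m ρ D (u n - u k) (u n - u k) = ‖w n - w k‖ ^ 2 :=
    fun n k => h.form_sub (hu' n) (hu' k)
  simp_rw [hform] at hc
  have hcu : CauchySeq u := by
    refine Metric.cauchySeq_iff.2 fun ε hε => ?_
    obtain ⟨N, hN⟩ := hc (ε ^ 2) (by positivity)
    refine ⟨N, fun n hn k hk => ?_⟩
    rw [dist_eq_norm]
    exact lt_of_pow_lt_pow_left₀ 2 hε.le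
      ((le_add_of_nonneg_left (sq_nonneg _)).trans_lt (hN n hn k hk))
  have hcw : CauchySeq w := by
    refine Metric.cauchySeq_iff.2 fun ε hε => ?_
    obtain ⟨N, hN⟩ := hc (ε ^ 2) (by positivity)
    refine ⟨N, fun n hn k hk => ?_⟩
    rw [dist_eq_norm]
    exact lt_of_pow_lt_pow_left₀ 2 hε.le
      ((le_add_of_nonneg_right (sq_nonneg _)).trans_lt (hN n hn k hk))
  obtain ⟨v, hv⟩ := cauchySeq_tendsto_of_complete hcu
  obtain ⟨z, hz⟩ := cauchySeq_tendsto_of_complete hcw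
  obtain ⟨ns, hns, hnsv⟩ := (tendstoInMeasure_of_tendsto_Lp hv).exists_seq_tendsto_ae
  -- The second subsequence is extracted from the first, so that both almost sure limits hold along
  -- it.
  obtain ⟨ms, hms, hmsz⟩ := (tendstoInMeasure_of_tendsto_Lp
    (hz.comp hns.tendsto_atTop)).exists_seq_tendsto_ae
  have hDv : D v =ᵐ[ρ] z := by
    filter_upwards [h.ae _ hnsv, hmsz, ae_all_iff.2 fun n => (hu' n).coeFn_toLp]
      with y ⟨a, b, ha, hb, hF⟩ h1 h2
    have h3 : Tendsto (fun k => D (u (ns (ms k))) y) atTop (𝓝 (D v y)) := by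
      simp only [hF]
      exact (ha.comp hms.tendsto_atTop).sub (hb.comp hms.tendsto_atTop)
    refine tendsto_nhds_unique h3 (h1.congr fun k => ?_)
    exact h2 _
  have hvD : MemLp (D v) 2 ρ := (memLp_congr_ae hDv).2 (Lp.memLp z)
  have hzv : hvD.toLp = z := Lp.ext (hvD.coeFn_toLp.trans hDv)
  refine ⟨v, hvD, ?_⟩
  have h1 : ∀ n, differenceForm m ρ D (u n - v) (u n - v) = ‖w n - z‖ ^ 2 := fun n => by
    rw [h.form_sub (hu' n) hvD, hzv]
  simp_rw [h1]
  have h2 := (tendsto_iff_norm_sub_tendsto_zero.1 hz).pow 2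
  have h3 := (tendsto_iff_norm_sub_tendsto_zero.1 hv).pow 2
  simpa using h2.add h3

theorem isDirichletForm (h : IsDifference m ρ D)
    (hdense : Dense (differenceDomain m ρ D)) :
    IsDirichletForm m (differenceDomain m ρ D) (differenceForm m ρ D) where
  zero_mem := by
    refine (memLp_congr_ae (f := 0) ?_).1 MemLp.zero
    filter_upwards [h.ae _ (Lp.coeFn_zero ℝ 2 m)] with y ⟨a, b, ha, hb, hF⟩
    rw [hF, ha, hb]
    simp
  add_mem u hu v hv := (memLp_congr_ae (h.ae_add u v)).2 (MemLp.add hu hv)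
  smul_mem c u hu := (memLp_congr_ae (h.ae_smul c u)).2 (MemLp.const_smul hu c)
  dense := hdense
  add_left u hu v hv w hw := by
    refine Eq.trans (integral_congr_ae ?_)
      (integral_add (MemLp.integrable_mul hu hw) (MemLp.integrable_mul hv hw))
    filter_upwards [h.ae_add u v] with y hy
    rw [hy, Pi.add_apply, add_mul]
  smul_left c u hu w hw := by
    rw [differenceForm, differenceForm, ← integral_const_mul]
    refine integral_congr_ae ?_
    filter_upwards [h.ae_smul c u] with y hy
    rw [hy, Pi.smul_apply, smul_eq_mul, mul_assoc]
  symm u hu v hv := integral_congr_ae (Eventually.of_forall fun y => mul_comm _ _)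
  nonneg u hu := integral_nonneg fun y => mul_self_nonneg _
  closed := h.closed
  markov u hu := by
    obtain ⟨v, hv, hvu, hD⟩ := h.exists_clip hu le_rfl zero_le_one
    refine ⟨v, hv, hvu, integral_mono_ae (MemLp.integrable_mul hv hv) (MemLp.integrable_mul hu hu) ?_⟩
    filter_upwards [hD] with y hy
    change D v y * D v y ≤ D u y * D u y
    rw [← abs_mul_abs_self, ← abs_mul_abs_self (D u y)]
    gcongr

theorem exists_mem_of_continuous [TopologicalSpace X] [BorelSpace X] [IsFiniteMeasure m]
    [IsFiniteMeasure ρ] (h : IsDifference m ρ D) {f : X → ℝ}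
    (hf : Continuous f) (hfc : HasCompactSupport f) :
    ∃ v ∈ differenceDomain m ρ D, v =ᵐ[m] f := by
  obtain ⟨C, hC⟩ := hfc.exists_bound_of_continuous hf
  have hm : MemLp f 2 m :=
    MemLp.of_bound hf.measurable.aestronglyMeasurable C (Eventually.of_forall hC)
  refine ⟨hm.toLp, h.mem_of_bound (M := C) ?_, hm.coeFn_toLp⟩
  filter_upwards [hm.coeFn_toLp] with x hx
  rw [hx]
  exact hC x

section Regular

variable [TopologicalSpace X] [LocallyCompactSpace X] [TopologicalSpace.SeparableSpace X]
  [TopologicalSpace.MetrizableSpace X] [BorelSpace X] [IsFiniteMeasure m] [IsFiniteMeasure ρ]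

/-- Continuous compactly supported `L²(m)` approximants are truncated at the bound `M` of `u`, which
brings them no further from `u`. Along an almost surely convergent subsequence the differences
converge, dominated by the constant `4M`, which is in `L²(ρ)` because `ρ` is finite. -/
theorem exists_continuous_approx (h : IsDifference m ρ D) {u : Lp ℝ 2 m} {M : ℝ}
    (hM : ∀ᵐ x ∂m, |u x| ≤ M) {ε : ℝ} (hε : 0 < ε) :
    ∃ v ∈ differenceDomain m ρ D, (∃ f : X → ℝ, Continuous f ∧ HasCompactSupport f ∧ v =ᵐ[m] f) ∧
      differenceForm m ρ D (u - v) (u - v) + ‖u - v‖ ^ 2 < ε := by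
  -- Nonnegativity of `M` makes the truncation fix `0`, so that it preserves compact supports.
  wlog hM0 : 0 ≤ M generalizing M
  · exact this (M := |M|) (hM.mono fun x hx => hx.trans (le_abs_self M)) (abs_nonneg _)
  choose g hg hgc hgm hgu using fun n : ℕ =>
    exists_continuous_approx_Lp m u (Nat.one_div_pos_of_nat (n := n) (α := ℝ))
  set f : ℕ → X → ℝ := fun n x => min (max (g n x) (-M)) M with hf
  have hfM : ∀ n x, |f n x| ≤ M := fun n x =>
    abs_le.2 ⟨le_min (le_max_right _ _) (by linarith), min_le_right _ _⟩
  have hfc : ∀ n, Continuous (f n) := fun n => by fun_prop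
  have hfcc : ∀ n, HasCompactSupport (f n) := fun n =>
    (hgc n).comp_left (g := fun t : ℝ => min (max t (-M)) M) (by simp [hM0])
  choose v hv hvf using fun n => h.exists_mem_of_continuous (hfc n) (hfcc n)
  have hvM : ∀ n, ∀ᵐ x ∂m, |v n x| ≤ M := fun n => (hvf n).mono fun x hx => hx ▸ hfM n x
  have hle : ∀ n, ‖v n - u‖ ≤ 1 / ((n : ℝ) + 1) := by
    intro n
    rw [norm_sub_rev]
    refine (Lp.norm_le_norm_of_ae_le ?_).trans (hgu n).le
    filter_upwards [Lp.coeFn_sub u (v n), Lp.coeFn_sub u (hgm n).toLp, (hgm n).coeFn_toLp, hvf n,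
      hM] with x h1 h2 h3 h4 h5
    rw [h1, h2, Pi.sub_apply, Pi.sub_apply, h3, h4]
    have := abs_clip_sub_le (-M) M (u x) (g n x)
    rwa [max_eq_left (abs_le.1 h5).1, min_eq_left (abs_le.1 h5).2] at this
  have hlim : Tendsto (fun n => ‖v n - u‖) atTop (𝓝 0) :=
    squeeze_zero (fun n => norm_nonneg _) hle tendsto_one_div_add_atTop_nhds_zero_nat
  obtain ⟨ns, hns, hnsv⟩ := (tendstoInMeasure_of_tendsto_Lp
    (tendsto_iff_norm_sub_tendsto_zero.2 hlim)).exists_seq_tendsto_ae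
  have h1 : Tendsto (fun n => differenceForm m ρ D (u - v (ns n)) (u - v (ns n))) atTop (𝓝 0) := by
    refine tendsto_integral_mul_self_zero (g := fun _ => (M + M) + (M + M)) (memLp_const _)
      (fun n => (h.measurable_coe _).aestronglyMeasurable) (fun n => ?_) ?_
    · filter_upwards [h.ae_sub u (v (ns n)), h.ae _ (hM.and (hvM (ns n)))]
        with y h1 ⟨a, b, ha, hb, hF⟩
      rw [h1, Pi.sub_apply, hF, hF]
      refine (abs_sub _ _).trans (add_le_add ?_ ?_)
      · exact (abs_sub _ _).trans (add_le_add ha.1 hb.1)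
      · exact (abs_sub _ _).trans (add_le_add ha.2 hb.2)
    · filter_upwards [h.ae _ hnsv, ae_all_iff.2 fun n => h.ae_sub u (v (ns n))]
        with y ⟨a, b, ha, hb, hF⟩ h1
      simp only [h1, Pi.sub_apply, hF]
      have := (tendsto_const_nhds (x := u a - u b)).sub (ha.sub hb)
      rwa [sub_self] at this
  have h2 : Tendsto (fun n => ‖u - v (ns n)‖ ^ 2) atTop (𝓝 0) := by
    simp_rw [norm_sub_rev u]
    simpa using (hlim.comp hns.tendsto_atTop).pow 2
  have h3 := h1.add h2
  rw [add_zero] at h3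
  obtain ⟨n, hn⟩ := (h3.eventually_lt_const hε).exists
  exact ⟨v (ns n), hv _, ⟨f (ns n), hfc _, hfcc _, hvf _⟩, hn⟩

theorem isRegularDirichletForm (h : IsDifference m ρ D) :
    IsRegularDirichletForm m (differenceDomain m ρ D) (differenceForm m ρ D) where
  toIsDirichletForm := by
    refine h.isDirichletForm (Metric.dense_iff.2 fun u ε hε => ?_)
    obtain ⟨f, hf, hfc, hfm, hfu⟩ := exists_continuous_approx_Lp m u hε
    obtain ⟨v, hv, hvf⟩ := h.exists_mem_of_continuous hf hfc
    have : v = hfm.toLp := Lp.ext (hvf.trans hfm.coeFn_toLp.symm)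
    refine ⟨v, ?_, hv⟩
    rw [Metric.mem_ball, dist_comm, dist_eq_norm, this]
    exact hfu
  finite_on_compacts K _ := measure_lt_top m K
  dense_domain u hu ε hε := by
    -- `ε / 4` twice, because `form_sub_le` costs a factor 2 on each term.
    obtain ⟨v, hv, ⟨M, hM⟩, huv⟩ := h.exists_bounded_approx hu (ε := ε / 4) (by positivity)
    obtain ⟨w, hw, hwf, hvw⟩ := h.exists_continuous_approx hM (ε := ε / 4) (by positivity)
    refine ⟨w, hw, hwf, (h.form_sub_le hu hv hw).trans_lt ?_⟩
    linarith
  dense_uniform g hg hgc ε hε :=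
    -- `g` itself serves, being bounded and hence in the domain.
    ⟨g, hg, hgc, h.exists_mem_of_continuous hg hgc, fun x => by simpa using hε⟩

end Regular

end IsDifference

end DifferenceForm

/-! ### The form of the Poisson space as a difference form. -/

section Birth

variable {E : Type*} [MeasurableSpace E] {μ : Measure E} [SigmaFinite μ] {S : Set (Config E)}

instance : IsProbabilityMeasure (poissonMeasure μ) :=
  (isPoissonMeasure_poissonMeasure μ).isProbabilityMeasure

theorem ae_restr_iff {π : Measure (Config E)} (hS : MeasurableSet S) {P : S → Prop} :
    (∀ᵐ x ∂(restr π S), P x) ↔ ∀ᵐ γ ∂π, ∀ h : γ ∈ S, P ⟨γ, h⟩ := by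
  rw [restr, ae_iff, ae_iff, comap_subtype_coe_apply hS]
  congr! 2
  ext γ
  simp

theorem extendZero_apply (F : S → ℝ) (x : S) : extendZero F x = F x :=
  Subtype.val_injective.extend_apply _ _ _

theorem measurable_extendZero (hS : MeasurableSet S) {F : S → ℝ} (hF : Measurable F) :
    Measurable (extendZero F) :=
  (MeasurableEmbedding.subtype_coe hS).measurable_extend hF measurable_zero

/-- Almost surely both `γ + δ_z` and `γ` lie in `S` and avoid the exceptional set: the former by the
Mecke formula, the latter by projection. So the extension by `0` outside `S` is never seen. -/
theorem isDifference_diff (hS : MeasurableSet S) (hS0 : poissonMeasure μ Sᶜ = 0)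
    {ρ : Measure (Config E × E)} (hρ : ρ ≪ (poissonMeasure μ).prod μ) :
    IsDifference (restr (poissonMeasure μ) S) ρ fun F => diff (extendZero F) where
  measurable F hF := ((measurable_extendZero hS hF).comp measurable_addDirac).sub
    ((measurable_extendZero hS hF).comp measurable_fst)
  ae P hP := by
    have h1 : ∀ᵐ γ ∂(poissonMeasure μ), ∃ x : S, x.1 = γ ∧ P x := by
      filter_upwards [(ae_restr_iff hS).1 hP, (mem_ae_iff.2 hS0 : S ∈ ae _)] with γ h1 h2
      exact ⟨⟨γ, h2⟩, rfl, h1 h2⟩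
    have h2 : Measure.QuasiMeasurePreserving Prod.fst ((poissonMeasure μ).prod μ)
        (poissonMeasure μ) := Measure.quasiMeasurePreserving_fst
    refine hρ.ae_le ?_
    filter_upwards [h2.ae h1,
      (isPoissonMeasure_poissonMeasure μ).quasiMeasurePreserving_addDirac.ae h1]
      with p ⟨b, hb, hPb⟩ ⟨a, ha, hPa⟩
    refine ⟨a, b, hPa, hPb, fun F => ?_⟩
    rw [diff, ← ha, ← hb, extendZero_apply, extendZero_apply]

theorem isRegularDirichletForm_birthForm {ψ : Config E × E → ℝ} (hψ : Measurable ψ)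
    (hψ0 : ∀ p, 0 ≤ ψ p) (hψi : Integrable ψ ((poissonMeasure μ).prod μ))
    [TopologicalSpace S] [LocallyCompactSpace S] [TopologicalSpace.SeparableSpace S]
    [TopologicalSpace.MetrizableSpace S] [BorelSpace S] (hS : MeasurableSet S)
    (hS0 : poissonMeasure μ Sᶜ = 0) :
    IsRegularDirichletForm (restr (poissonMeasure μ) S) (birthDomain μ ψ S)
      (birthForm μ ψ S) := by
  -- The weight moves into the measure; integrability of `ψ` is exactly what makes `ρ` finite, and
  -- it stays absolutely continuous.
  set ρ := ((poissonMeasure μ).prod μ).withDensity fun p => ENNReal.ofReal (ψ p) with hρ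
  have : IsFiniteMeasure ρ := isFiniteMeasure_withDensity_ofReal hψi.2
  have : IsFiniteMeasure (restr (poissonMeasure μ) S) :=
    by rw [restr]; infer_instance
  have hD : IsDifference (restr (poissonMeasure μ) S) ρ fun F => diff (extendZero F) :=
    isDifference_diff hS hS0 (withDensity_absolutelyContinuous _ _)
  have hdom : birthDomain μ ψ S = differenceDomain (restr (poissonMeasure μ) S) ρ
      fun F => diff (extendZero F) := by
    ext F
    have hm := hD.measurable_coe F
    change (∫⁻ p, ENNReal.ofReal (diff (extendZero F) p ^ 2 * ψ p) ∂((poissonMeasure μ).prod μ) < ∞)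
      ↔ MemLp (diff (extendZero F)) 2 ρ
    rw [memLp_two_iff_integrable_sq hm.aestronglyMeasurable, Integrable,
      and_iff_right (hm.pow_const 2).aestronglyMeasurable,
      hasFiniteIntegral_iff_ofReal (Filter.Eventually.of_forall fun p => sq_nonneg _), hρ,
      lintegral_withDensity_eq_lintegral_mul _ hψ.ennreal_ofReal (hm.pow_const 2).ennreal_ofReal]
    refine iff_of_eq (congrArg (· < ∞) (lintegral_congr fun p => ?_))
    rw [Pi.mul_apply, ← ENNReal.ofReal_mul (hψ0 p), mul_comm]
  have hform : birthForm μ ψ S = differenceForm (restr (poissonMeasure μ) S) ρ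
      fun F => diff (extendZero F) := by
    ext F G
    rw [birthForm, differenceForm, hρ, integral_withDensity_eq_integral_toReal_smul
      hψ.ennreal_ofReal (Filter.Eventually.of_forall fun _ => ENNReal.ofReal_lt_top)]
    refine integral_congr_ae (Filter.Eventually.of_forall fun p => ?_)
    simp only [ENNReal.toReal_ofReal (hψ0 p), smul_eq_mul]
    ring
  rw [hdom, hform]
  exact hD.isRegularDirichletForm

end Birth

/-! ### Exhaustion by disjoint compact sets and their disjoint-union topology. -/

section CompactExhaustion

open Filter Topology

variable {X : Type*} [TopologicalSpace X] [PolishSpace X] [MeasurableSpace X] [BorelSpace X]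

/-- A compact set may be shrunk by a null set so that it carries its measure with full support. -/
theorem exists_isCompact_self_support (m : Measure X) {C : Set X} (hC : IsCompact C) :
    ∃ C' ⊆ C, IsCompact C' ∧ m (C \ C') = 0 ∧
      ∀ V, IsOpen V → (V ∩ C').Nonempty → m (V ∩ C') ≠ 0 := by
  have h0 : m (C \ (C ∩ (m.restrict C).support)) = 0 := by
    rw [Set.sdiff_self_inter, Set.sdiff_eq_compl_inter,
      ← Measure.restrict_apply Measure.isOpen_compl_support.measurableSet]
    exact Measure.measure_compl_support
  refine ⟨C ∩ (m.restrict C).support, Set.inter_subset_left,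
    hC.inter_right Measure.isClosed_support, h0, ?_⟩
  rintro V hV ⟨x, hxV, hxC, hx⟩ hVC
  have h1 := (Measure.mem_support_iff_forall x).1 hx V (hV.mem_nhds hxV)
  rw [Measure.restrict_apply hV.measurableSet] at h1
  -- If `V ∩ C'` were null, so would be `V ∩ C`, since `C \ C'` is null; but `x` is in the support
  -- of the restriction to `C`.
  refine h1.ne' (measure_mono_null (t := (V ∩ (C ∩ (m.restrict C).support)) ∪
    (C \ (C ∩ (m.restrict C).support))) (fun y hy => ?_) (measure_union_null hVC h0))
  by_cases hy' : y ∈ (m.restrict C).support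
  · exact Or.inl ⟨hy.1, hy.2, hy'⟩
  · exact Or.inr ⟨hy.2, fun h => hy' h.2⟩

/-- The induction step of the exhaustion: inner regularity on the open complement of `K` gives a
compact set disjoint from `K`, which is then reduced to its support at no cost in measure. -/
theorem exists_isCompact_disjoint (m : Measure X) [IsFiniteMeasure m] {K : Set X}
    (hK : IsCompact K) {ε : ℝ≥0∞} (hε : ε ≠ 0) :
    ∃ C, IsCompact C ∧ Disjoint K C ∧ m (K ∪ C)ᶜ ≤ ε ∧
      ∀ V, IsOpen V → (V ∩ C).Nonempty → m (V ∩ C) ≠ 0 := by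
  have hKm : MeasurableSet Kᶜ := hK.isClosed.measurableSet.compl
  obtain ⟨C, hCK, hC, hCε⟩ : ∃ C ⊆ Kᶜ, IsCompact C ∧ m (Kᶜ \ C) ≤ ε := by
    -- `m Kᶜ - ε < m Kᶜ`, needed for inner regularity, fails when `m Kᶜ = 0`.
    by_cases h0 : m Kᶜ = 0
    · exact ⟨∅, Set.empty_subset _, isCompact_empty, by simp [h0]⟩
    · obtain ⟨C, hCK, hC, hlt⟩ := innerRegular_isCompact_isClosed_measurableSet_of_finite m hKm
        (m Kᶜ - ε) (ENNReal.sub_lt_self (measure_ne_top _ _) h0 hε)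
      refine ⟨C, hCK, hC.1, ?_⟩
      rw [measure_sdiff hCK hC.2.measurableSet.nullMeasurableSet (measure_ne_top _ _),
        tsub_le_iff_left, ← tsub_le_iff_right]
      exact hlt.le
  obtain ⟨C', hC'C, hC', h0, hpos⟩ := exists_isCompact_self_support m hC
  refine ⟨C', hC', Set.disjoint_left.2 fun x hx hx' => hCK (hC'C hx') hx, ?_, hpos⟩
  calc m (K ∪ C')ᶜ ≤ m ((Kᶜ \ C) ∪ (C \ C')) := measure_mono fun x hx => by
        rw [Set.compl_union] at hx
        by_cases hxC : x ∈ C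
        · exact Or.inr ⟨hxC, hx.2⟩
        · exact Or.inl ⟨hx.1, hxC⟩
    _ ≤ m (Kᶜ \ C) + m (C \ C') := measure_union_le _ _
    _ ≤ ε := by rwa [h0, add_zero]

/-- A finite measure on a Polish space is exhausted by disjoint compact sets, each of which carries
its measure with full support. -/
theorem exists_disjoint_compact_exhaustion (m : Measure X) [IsFiniteMeasure m] {ε : ℕ → ℝ≥0∞}
    (hε : ∀ n, ε n ≠ 0) :
    ∃ C : ℕ → Set X, (∀ n, IsCompact (C n)) ∧ (Pairwise fun i j => Disjoint (C i) (C j)) ∧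
      (∀ n, m (⋃ i ≤ n, C i)ᶜ ≤ ε n) ∧
      ∀ n V, IsOpen V → (V ∩ C n).Nonempty → m (V ∩ C n) ≠ 0 := by
  choose! F hFc hFd hFε hFpos using fun (K : Set X) (hK : IsCompact K) (n : ℕ) =>
    exists_isCompact_disjoint m hK (hε n)
  -- `K n` is the union of the pieces chosen before stage `n`; the new piece `F (K n) n` avoids all
  -- of them.
  obtain ⟨K, hK0, hKs⟩ : ∃ K : ℕ → Set X, K 0 = ∅ ∧ ∀ n, K (n + 1) = K n ∪ F (K n) n :=
    ⟨fun n => Nat.rec ∅ (fun n K => K ∪ F K n) n, rfl, fun n => rfl⟩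
  have hK : ∀ n, IsCompact (K n) := by
    intro n
    induction n with
    | zero => rw [hK0]; exact isCompact_empty
    | succ n ih => rw [hKs]; exact ih.union (hFc _ ih n)
  have hmono : Monotone K := monotone_nat_of_le_succ fun n => by
    rw [hKs]; exact Set.subset_union_left
  have hKC : ∀ n, K (n + 1) = ⋃ i ≤ n, F (K i) i := by
    intro n
    induction n with
    | zero => rw [hKs]; simp [hK0]
    | succ n ih => rw [Set.biUnion_le_succ, ← ih, ← hKs]
  refine ⟨fun n => F (K n) n, fun n => hFc _ (hK n) n, ?_, fun n => ?_, fun n => hFpos _ (hK n) n⟩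
  · have hlt : ∀ i j, i < j → Disjoint (F (K i) i) (F (K j) j) := fun i j hij =>
      (hFd _ (hK j) j).mono_left ((hKs i ▸ Set.subset_union_right : F (K i) i ⊆ K (i + 1)).trans
        (hmono hij))
    intro i j hij
    rcases lt_or_gt_of_ne hij with h | h
    · exact hlt i j h
    · exact (hlt j i h).symm
  · rw [← hKC, hKs]
    exact hFε _ (hK n) n

/-- The topology of a disjoint union of compact sets. -/
theorem exists_topology_disjoint_union {Z : Type*} [mZ : MeasurableSpace Z] {j : Z → X}
    (hj : Function.Injective j) (hmZ : mZ = MeasurableSpace.comap j inferInstance)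
    {C : ℕ → Set X} (hC : ∀ n, IsCompact (C n)) (hd : Pairwise fun i j => Disjoint (C i) (C j))
    (hr : Set.range j = ⋃ n, C n) (m : Measure X) (ν : Measure Z)
    (hν : ∀ n W, W ⊆ C n → ν (j ⁻¹' W) = m W)
    (hpos : ∀ n V, IsOpen V → (V ∩ C n).Nonempty → m (V ∩ C n) ≠ 0) :
    ∃ _ : TopologicalSpace Z, BorelSpace Z ∧ LocallyCompactSpace Z ∧
      TopologicalSpace.SeparableSpace Z ∧ TopologicalSpace.MetrizableSpace Z ∧
      ν.IsOpenPosMeasure ∧ (∀ n, IsCompact (j ⁻¹' ⋃ i ≤ n, C i)) ∧ Continuous j := by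
  have hmem : ∀ z, ∃ n, j z ∈ C n := fun z => Set.mem_iUnion.1 (hr ▸ Set.mem_range_self z)
  choose idx hidx using hmem
  have huniq : ∀ z n, j z ∈ C n → idx z = n := fun z n hz => by
    by_contra hne
    exact Set.disjoint_left.1 (hd hne) (hidx z) hz
  -- Recording the discrete index of the piece as a second coordinate makes each piece open and
  -- closed while keeping its topology from `X`; metrizability and second countability are inherited
  -- from `X × ℕ`.
  set f : Z → X × ℕ := fun z => (j z, idx z) with hf
  have hfi : Function.Injective f := fun a b hab => hj (congrArg Prod.fst hab)
  let : TopologicalSpace Z := TopologicalSpace.induced f inferInstance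
  have hind : IsInducing f := ⟨rfl⟩
  have hemb : IsEmbedding f := ⟨hind, hfi⟩
  have hjc : Continuous j := continuous_fst.comp hind.continuous
  have hic : Continuous idx := continuous_snd.comp hind.continuous
  have hpre : ∀ n, j ⁻¹' C n = idx ⁻¹' {n} := fun n =>
    Set.ext fun z => ⟨huniq z n, fun h => (show idx z = n from h) ▸ hidx z⟩
  have hcomp : ∀ n, IsCompact (j ⁻¹' C n) := by
    intro n
    rw [hind.isCompact_iff]
    have : f '' (j ⁻¹' C n) = C n ×ˢ {n} := by
      ext ⟨x, k⟩
      constructor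
      · rintro ⟨z, hz, hzx⟩
        rw [← hzx]
        exact ⟨hz, huniq z n hz⟩
      · rintro ⟨hx, hk⟩
        have hx' : x ∈ C n := hx
        obtain ⟨z, rfl⟩ : x ∈ Set.range j := hr ▸ Set.mem_iUnion.2 ⟨n, hx'⟩
        exact ⟨z, hx', Prod.ext rfl ((huniq z n hx').trans hk.symm)⟩
    rw [this]
    exact (hC n).prod isCompact_singleton
  have hmetr : TopologicalSpace.MetrizableSpace Z := hemb.metrizableSpace
  have hsc : SecondCountableTopology Z := hemb.secondCountableTopology
  refine ⟨inferInstance, ⟨?_⟩, ?_, inferInstance, hmetr, ⟨?_⟩, fun n => ?_, hjc⟩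
  · rw [borel_comap, ← BorelSpace.measurable_eq (α := X × ℕ)]
    refine le_antisymm ?_ ?_
    · rw [hmZ]
      refine MeasurableSpace.comap_le_iff_le_map.2 fun s hs => ?_
      exact ⟨Prod.fst ⁻¹' s, measurable_fst hs, rfl⟩
    · have hjm : Measurable j := measurable_iff_comap_le.2 hmZ.ge
      -- The finer topology creates no new Borel sets: `idx` is measurable, its fibres being
      -- preimages of the compact sets `C n`.
      refine measurable_iff_comap_le.1 (hjm.prodMk (measurable_to_countable' fun n => ?_))
      rw [← hpre]
      exact hjm (hC n).isClosed.measurableSet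
  · have : WeaklyLocallyCompactSpace Z := ⟨fun z => ⟨j ⁻¹' C (idx z), hcomp _, by
      rw [hpre]
      exact ((isOpen_discrete _).preimage hic).mem_nhds rfl⟩⟩
    infer_instance
  · rintro V hV ⟨z, hz⟩ h0
    obtain ⟨O, hO, rfl⟩ := isOpen_induced_iff.1 hV
    -- Within one piece an open set of `Z` is the trace of an open set of `X`, to which the full
    -- support of that piece applies.
    have hOn : IsOpen {x | (x, idx z) ∈ O} := hO.preimage (by fun_prop)
    refine hpos (idx z) _ hOn ⟨j z, hz, hidx z⟩ ?_
    rw [← hν _ _ Set.inter_subset_right]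
    refine measure_mono_null (fun y hy => ?_) h0
    have hy1 : (j y, idx z) ∈ O := hy.1
    have hy2 : idx y = idx z := huniq y _ hy.2
    change (j y, idx y) ∈ O
    rwa [hy2]
  · rw [Set.preimage_iUnion₂]
    exact (Set.finite_Iic n).isCompact_biUnion fun i _ => hcomp i

end CompactExhaustion

/-! ### The locally compact full subspace. -/

section FullSubspace

variable {E : Type*} [MeasurableSpace E] {π : Measure (Config E)} {S : Set (Config E)}

/-- In a Polish full subspace there are compact sets whose union is a locally compact full
subspace. -/
theorem exists_locallyCompact_fullSubspace [IsFiniteMeasure π] [TopologicalSpace S] [PolishSpace S]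
    (hS : IsFullSubspace π S) {ε : ℕ → ℝ≥0∞} (hε : ∀ n, ε n ≠ 0)
    (hε0 : Filter.Tendsto ε Filter.atTop (nhds 0)) :
    ∃ (K : ℕ → Set (Config E)) (hK : ∀ n, K n ⊆ S), Monotone K ∧
      (∀ n, IsCompact (Subtype.val ⁻¹' K n : Set S)) ∧ (∀ n, π (K n)ᶜ ≤ ε n) ∧
      ∃ _ : TopologicalSpace (⋃ n, K n : Set (Config E)),
        IsFullSubspace π (⋃ n, K n) ∧
        LocallyCompactSpace (⋃ n, K n : Set (Config E)) ∧
        TopologicalSpace.SeparableSpace (⋃ n, K n : Set (Config E)) ∧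
        TopologicalSpace.MetrizableSpace (⋃ n, K n : Set (Config E)) ∧
        (restr π (⋃ n, K n)).IsOpenPosMeasure ∧
        (∀ n, IsCompact (Subtype.val ⁻¹' K n : Set (⋃ n, K n : Set (Config E)))) ∧
        Continuous (Set.inclusion (Set.iUnion_subset hK)) := by
  have := hS.borelSpace
  have : IsFiniteMeasure (restr π S) := by rw [restr]; infer_instance
  have hSe := MeasurableEmbedding.subtype_coe hS.measurableSet
  obtain ⟨C, hC, hd, hCε, hpos⟩ := exists_disjoint_compact_exhaustion (restr π S) hε
  set K : ℕ → Set (Config E) := fun n => Subtype.val '' ⋃ i ≤ n, C i with hKdef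
  have hKc : ∀ n, IsCompact (⋃ i ≤ n, C i) := fun n =>
    (Set.finite_Iic n).isCompact_biUnion fun i _ => hC i
  have hKS : ∀ n, K n ⊆ S := fun n => Subtype.coe_image_subset _ _
  have hpreS : ∀ n, (Subtype.val ⁻¹' K n : Set S) = ⋃ i ≤ n, C i := fun n =>
    Set.preimage_image_eq _ Subtype.val_injective
  have hKm : ∀ n, MeasurableSet (K n) := fun n =>
    hSe.measurableSet_image.2 (hKc n).isClosed.measurableSet
  have hKε : ∀ n, π (K n)ᶜ ≤ ε n := by
    intro n
    refine le_trans ?_ (hCε n)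
    rw [restr, comap_subtype_coe_apply hS.measurableSet]
    refine (measure_mono (t := Sᶜ ∪ Subtype.val '' (⋃ i ≤ n, C i)ᶜ) fun γ hγ => ?_).trans
      ((measure_union_le _ _).trans ?_)
    · by_cases hγS : γ ∈ S
      · exact Or.inr ⟨⟨γ, hγS⟩, fun h => hγ ⟨_, h, rfl⟩, rfl⟩
      · exact Or.inl hγS
    · rw [hS.measure_compl, zero_add]
  have hU : MeasurableSet (⋃ n, K n) := MeasurableSet.iUnion hKm
  have hUfull : π (⋃ n, K n)ᶜ = 0 := by
    refine le_antisymm (ge_of_tendsto' hε0 fun n => ?_) zero_le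
    exact (measure_mono (Set.compl_subset_compl.2 (Set.subset_iUnion K n))).trans (hKε n)
  refine ⟨K, hKS, fun i k hik => Set.image_mono (Set.biUnion_mono (Set.Iic_subset_Iic.2 hik)
    fun _ _ => subset_rfl), fun n => hpreS n ▸ hKc n, hKε, ?_⟩
  set j := Set.inclusion (Set.iUnion_subset hKS) with hj
  have hr : Set.range j = ⋃ n, C n := by
    rw [hj, Set.range_inclusion]
    change Subtype.val ⁻¹' (⋃ n, K n) = _
    rw [Set.preimage_iUnion]
    simp_rw [hpreS]
    exact Set.biUnion_le_eq_iUnion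
  -- The σ-field on the union is the trace of that of the configuration space, hence also that of
  -- `S`; the two restricted measures agree on subsets of each `C n`.
  obtain ⟨t, h1, h2, h3, h4, h5, h6, h7⟩ := exists_topology_disjoint_union
    (Z := (⋃ n, K n : Set (Config E))) (j := j) (Set.inclusion_injective _) (by
      change MeasurableSpace.comap _ _ = MeasurableSpace.comap _ (MeasurableSpace.comap _ _)
      rw [MeasurableSpace.comap_comp]
      rfl) hC hd hr (restr π S) (restr π (⋃ n, K n)) (fun n W hW => by
      rw [restr, restr, comap_subtype_coe_apply hU, comap_subtype_coe_apply hS.measurableSet]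
      congr 1
      ext γ
      constructor
      · rintro ⟨z, hz, rfl⟩
        exact ⟨_, hz, rfl⟩
      · rintro ⟨x, hx, rfl⟩
        obtain ⟨z, rfl⟩ : x ∈ Set.range j := hr ▸ Set.mem_iUnion.2 ⟨n, hW hx⟩
        exact ⟨z, hx, rfl⟩) hpos
  refine ⟨t, ⟨hU, hUfull, h1⟩, h2, h3, h4, h5, fun n => ?_, h7⟩
  have := h6 n
  rwa [← hpreS, ← Set.preimage_comp] at this

end FullSubspace

/-! ### Standard Borel structures on samples and on images. -/

section StandardBorel

/-- The disjoint-union topology is Polish; since its countably many summands are open, its Borel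
σ-field is the given one, which is tested summand by summand. -/
theorem standardBorelSpace_sample {E : Type*} [MeasurableSpace E] [StandardBorelSpace E] :
    StandardBorelSpace (Sample E) := by
  let := upgradeStandardBorel E
  have hsc : SecondCountableTopology (Sample E) :=
    inferInstanceAs (SecondCountableTopology (Σ n : ℕ, (Fin n → E)))
  have hcm : TopologicalSpace.IsCompletelyMetrizableSpace (Sample E) :=
    inferInstanceAs (TopologicalSpace.IsCompletelyMetrizableSpace (Σ n : ℕ, (Fin n → E)))
  have hemb : ∀ n, Topology.IsOpenEmbedding (mkSample (E := E) n) := fun n =>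
    Topology.IsOpenEmbedding.sigmaMk (σ := fun n : ℕ => Fin n → E) (i := n)
  have : BorelSpace (Sample E) := by
    refine ⟨le_antisymm (fun s hs => ?_) (MeasurableSpace.generateFrom_le fun s hs =>
      measurableSet_sample.2 fun n => (IsOpen.preimage (hemb n).continuous hs).measurableSet)⟩
    have hU : s = ⋃ n, mkSample n '' (mkSample n ⁻¹' s) := by
      ext ⟨n, x⟩
      simp only [Set.mem_iUnion]
      refine ⟨fun h => ⟨n, x, h, rfl⟩, ?_⟩
      rintro ⟨k, y, hy, hyx⟩
      rw [← hyx]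
      exact hy
    rw [hU]
    refine @MeasurableSet.iUnion _ _ (borel (Sample E)) _ _ fun n => ?_
    let : MeasurableSpace (Sample E) := borel (Sample E)
    have : BorelSpace (Sample E) := ⟨rfl⟩
    exact (hemb n).measurableEmbedding.measurableSet_image.2 (measurableSet_sample.1 hs n)
  have : PolishSpace (Sample E) := ⟨⟩
  infer_instance

/-- Transport of a standard Borel structure along an injective measurable parametrization. -/
theorem standardBorelSpace_of_bijective {X S T : Type*} [MeasurableSpace X] [StandardBorelSpace X]
    [MeasurableSpace S] [MeasurableSpace T] [MeasurableSpace.CountablySeparated T] {g : X → S}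
    (hg : Measurable g) (hsurj : Function.Surjective g) {φ : S → T} (hφ : Measurable φ)
    (hinj : Function.Injective (φ ∘ g)) : StandardBorelSpace S := by
  -- Lusin–Souslin, applied to `φ ∘ g` since nothing is known about the σ-field of `S`. As `g` is
  -- onto, the image of `u` under `g` is the `φ`-preimage of the measurable set `φ ∘ g '' u`.
  have hemb : MeasurableEmbedding (φ ∘ g) := (hφ.comp hg).measurableEmbedding hinj
  have hgi : Function.Injective g := hinj.of_comp
  have himg : ∀ u, g '' u = φ ⁻¹' (φ ∘ g '' u) := by
    intro u
    ext s
    obtain ⟨x, rfl⟩ := hsurj s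
    rw [hgi.mem_set_image, Set.mem_preimage]
    exact (hinj.mem_set_image (a := x)).symm
  have hge : MeasurableEmbedding g := ⟨hgi, hg, fun u hu => by
    rw [himg]
    exact hφ (hemb.measurableSet_image.2 hu)⟩
  let e : X ≃ S := Equiv.ofBijective g ⟨hgi, hsurj⟩
  obtain ⟨_, _, _⟩ := StandardBorelSpace.polish (α := X)
  let : TopologicalSpace S := TopologicalSpace.induced e.symm inferInstance
  have hind : Topology.IsInducing e.symm := ⟨rfl⟩
  have hcl : Topology.IsClosedEmbedding e.symm :=
    ⟨⟨hind, e.symm.injective⟩, by rw [e.symm.surjective.range_eq]; exact isClosed_univ⟩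
  refine ⟨inferInstance, ⟨?_⟩, hcl.polishSpace⟩
  rw [borel_comap, ← BorelSpace.measurable_eq (α := X)]
  refine le_antisymm (fun s hs => ⟨g ⁻¹' s, hg hs, ?_⟩) ?_
  · rintro _ ⟨u, hu, rfl⟩
    rw [← e.image_eq_preimage_symm u]
    exact hge.measurableSet_image.2 hu
  · have : g ∘ e.symm = id := funext e.apply_symm_apply
    rw [← Set.preimage_comp, this, Set.preimage_id]

end StandardBorel

/-! ### Encoding configurations by sorted samples. -/

section SortedSamples

variable {E : Type*}

theorem count_eq_card (A : Set E) (ω : Sample E) [DecidablePred fun j => ω.2 j ∈ A] :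
    count A ω = (Finset.univ.filter fun j => ω.2 j ∈ A).card := by
  rw [Finset.card_filter, count]
  exact Finset.sum_congr rfl fun j _ => by congr

/-- The samples of points of `B` that are sorted for the order given by `e`. -/
def sortedSamples (e : E → ℝ) (B : Set E) : Set (Sample E) :=
  {ω | Monotone (e ∘ ω.2) ∧ ∀ j, ω.2 j ∈ B}

theorem count_inter_of_mem {e : E → ℝ} {A B : Set E} {ω : Sample E}
    (hω : ω ∈ sortedSamples e B) : count (A ∩ B) ω = count A ω := by
  classical
  refine Finset.sum_congr rfl fun j _ => ?_
  simp [hω.2 j]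

theorem count_inter_of_disjoint {e : E → ℝ} {A B B' : Set E} (hd : Disjoint B B') {ω : Sample E}
    (hω : ω ∈ sortedSamples e B') : count (A ∩ B) ω = 0 := by
  classical
  refine Finset.sum_eq_zero fun j _ => if_neg fun h => ?_
  exact Set.disjoint_left.1 hd h.2 (hω.2 j)

/-- Sorted samples are determined by their distribution functions. -/
theorem apply_le_of_count_le {e : E → ℝ} {n k : ℕ} {x : Fin n → E} {y : Fin k → E}
    (hx : Monotone (e ∘ x)) (hy : Monotone (e ∘ y))
    (h : ∀ q : ℚ, count {z | e z ≤ q} (mkSample n x) ≤ count {z | e z ≤ q} (mkSample k y))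
    {i : ℕ} (hn : i < n) (hk : i < k) : e (y ⟨i, hk⟩) ≤ e (x ⟨i, hn⟩) := by
  classical
  by_contra! hlt
  -- Below `q` lie at least the `i + 1` points of `x` with index up to `i`, but at most the `i`
  -- points of `y` with smaller index.
  obtain ⟨q, hq1, hq2⟩ := exists_rat_btwn hlt
  have h1 : i + 1 ≤ count {z | e z ≤ q} (mkSample n x) := by
    rw [count_eq_card, ← Fin.card_Iic (⟨i, hn⟩ : Fin n)]
    refine Finset.card_le_card fun j hj => ?_
    rw [Finset.mem_Iic] at hj
    exact Finset.mem_filter.2 ⟨Finset.mem_univ _, (hx hj).trans hq1.le⟩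
  have h2 : count {z | e z ≤ q} (mkSample k y) ≤ i := by
    have hsub : (Finset.univ.filter fun j => e (y j) ≤ q) ⊆ Finset.Iio (⟨i, hk⟩ : Fin k) := by
      refine fun j hj => Finset.mem_Iio.2 (lt_of_not_ge fun hij => ?_)
      exact absurd (Finset.mem_filter.1 hj).2 (not_le.2 (hq2.trans_le (hy hij)))
    rw [count_eq_card]
    exact (Finset.card_le_card hsub).trans (Fin.card_Iio (⟨i, hk⟩ : Fin k)).le
  exact absurd (h1.trans ((h q).trans h2)) (by omega)

/-- For `q` above all the values of `e ∘ x`, the left count is the full size `n`. -/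
theorem size_le_of_count_le {e : E → ℝ} {n k : ℕ} {x : Fin n → E} {y : Fin k → E}
    (h : ∀ q : ℚ, count {z | e z ≤ q} (mkSample n x) ≤ count {z | e z ≤ q} (mkSample k y)) :
    n ≤ k := by
  classical
  obtain ⟨M, hM⟩ := (Set.finite_range (e ∘ x)).bddAbove
  obtain ⟨q, hq⟩ := exists_rat_gt M
  have h1 : count {z | e z ≤ q} (mkSample n x) = n := by
    rw [count_eq_card, Finset.filter_true_of_mem]
    · exact Finset.card_fin n
    · exact fun j _ => (hM ⟨j, rfl⟩).trans hq.le
  have h2 : count {z | e z ≤ q} (mkSample k y) ≤ k := by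
    rw [count_eq_card]
    exact (Finset.card_le_univ _).trans (Fintype.card_fin k).le
  exact h1 ▸ (h q).trans h2

theorem sortedSamples_ext {e : E → ℝ} (he : Function.Injective e) {B : Set E} {ω ω' : Sample E}
    (hω : ω ∈ sortedSamples e B) (hω' : ω' ∈ sortedSamples e B)
    (h : ∀ q : ℚ, count {z | e z ≤ q} ω = count {z | e z ≤ q} ω') : ω = ω' := by
  obtain ⟨n, x⟩ := ω
  obtain ⟨k, y⟩ := ω'
  obtain rfl : n = k := le_antisymm (size_le_of_count_le (e := e) fun q => (h q).le)
    (size_le_of_count_le (e := e) fun q => (h q).ge)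
  congr 1
  ext j
  exact he (le_antisymm (apply_le_of_count_le hω'.1 hω.1 (fun q => (h q).ge) j.2 j.2)
    (apply_le_of_count_le hω.1 hω'.1 (fun q => (h q).le) j.2 j.2))

variable [MeasurableSpace E]

theorem measurableSet_sortedSamples {e : E → ℝ} (he : Measurable e) {B : Set E}
    (hB : MeasurableSet B) : MeasurableSet (sortedSamples e B) := by
  refine measurableSet_sample.2 fun n => ?_
  have : mkSample n ⁻¹' sortedSamples e B =
      (⋂ i : Fin n, ⋂ j : Fin n, ⋂ _ : i ≤ j, {x | e (x i) ≤ e (x j)}) ∩ ⋂ j, {x | x j ∈ B} := by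
    ext x
    simp only [Set.mem_inter_iff, Set.mem_iInter]
    exact ⟨fun h => ⟨fun i j hij => h.1 hij, h.2⟩, fun h => ⟨fun i j hij => h.1 i j hij, h.2⟩⟩
  rw [this]
  refine MeasurableSet.inter (MeasurableSet.iInter fun i => MeasurableSet.iInter fun j =>
    MeasurableSet.iInter fun _ => measurableSet_le (he.comp (measurable_pi_apply i))
      (he.comp (measurable_pi_apply j))) (MeasurableSet.iInter fun j => measurable_pi_apply j hB)

/-- Each index `i` with `x i ∈ B` adds one to `γ(B)`, so there are finitely many, and they can be
enumerated in the order given by `e`. Sorting permutes the points and leaves the counts unchanged.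
-/
theorem exists_sortedSample (e : E → ℝ) (γ : Config E) {B : Set E} (hB : MeasurableSet B)
    (hfin : γ.1 B < ∞) :
    ∃ ω ∈ sortedSamples e B, ∀ A, MeasurableSet A → (count A ω : ℝ≥0∞) = γ.1 (A ∩ B) := by
  classical
  obtain ⟨γ, ι, _, x, rfl⟩ := γ
  have hsum : ∀ A, MeasurableSet A → Measure.sum (fun i => Measure.dirac (x i)) (A ∩ B) =
      ∑' i : {i | x i ∈ B}, if x i ∈ A then 1 else 0 := by
    intro A hA
    rw [Measure.sum_apply _ (hA.inter hB), tsum_subtype {i | x i ∈ B}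
      fun i => if x i ∈ A then (1 : ℝ≥0∞) else 0]
    refine tsum_congr fun i => ?_
    rw [Measure.dirac_apply' _ (hA.inter hB)]
    by_cases h1 : x i ∈ A <;> by_cases h2 : x i ∈ B <;> simp [h1, h2]
  have hI : Finite {i | x i ∈ B} := by
    have h1 := hsum Set.univ MeasurableSet.univ
    simp only [Set.univ_inter, Set.mem_univ, if_true] at h1
    rw [ENNReal.tsum_const, mul_one] at h1
    change Measure.sum (fun i => Measure.dirac (x i)) B < ∞ at hfin
    rw [h1] at hfin
    by_contra hinf
    rw [not_finite_iff_infinite] at hinf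
    simp at hfin
  obtain ⟨k, ⟨f⟩⟩ := Finite.exists_equiv_fin {i | x i ∈ B}
  set y : Fin k → E := fun j => x (f.symm j) with hy
  set s := Tuple.sort (e ∘ y) with hs
  refine ⟨mkSample k (y ∘ s), ⟨Tuple.monotone_sort (e ∘ y), fun j => (f.symm (s j)).2⟩,
    fun A hA => ?_⟩
  have := Fintype.ofFinite {i | x i ∈ B}
  change _ = Measure.sum (fun i => Measure.dirac (x i)) (A ∩ B)
  rw [hsum A hA, tsum_fintype, count]
  push_cast
  change (∑ j : Fin k, if x (f.symm (s j)) ∈ A then (1 : ℝ≥0∞) else 0) = _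
  exact Equiv.sum_comp (s.trans f.symm) fun i : {i | x i ∈ B} =>
    if x i ∈ A then (1 : ℝ≥0∞) else 0

/-- The configurations with finitely many points in each of countably many disjoint sets that cover
the space form a standard Borel space. -/
theorem standardBorelSpace_locallyFinite [StandardBorelSpace E] {B : ℕ → Set E}
    (hB : ∀ n, MeasurableSet (B n)) (hd : Pairwise fun i j => Disjoint (B i) (B j))
    (hU : ⋃ n, B n = Set.univ) :
    StandardBorelSpace {γ : Config E | ∀ n, γ.1 (B n) < ∞} := by
  have := standardBorelSpace_sample (E := E)
  set e := embeddingReal E with he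
  have hem : Measurable e := (measurableEmbedding_embeddingReal E).measurable
  have hei : Function.Injective e := (measurableEmbedding_embeddingReal E).injective
  set X : Set (ℕ → Sample E) := {ω | ∀ n, ω n ∈ sortedSamples e (B n)} with hX
  have hXm : MeasurableSet X := by
    rw [hX, Set.ofPred_forall]
    exact MeasurableSet.iInter fun n =>
      measurable_pi_apply n (measurableSet_sortedSamples hem (hB n))
  have : StandardBorelSpace X := hXm.standardBorel
  have hcount : ∀ ω ∈ X, ∀ n A, MeasurableSet A →
      (superpose ω).1 (A ∩ B n) = (count A (ω n) : ℝ≥0∞) := by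
    intro ω hω n A hA
    rw [superpose_apply _ (hA.inter (hB n)), tsum_eq_single n fun k hk => by
      rw [count_inter_of_disjoint (hd hk.symm) (hω k), Nat.cast_zero], count_inter_of_mem (hω n)]
  have hmem : ∀ ω : X, superpose ω.1 ∈ {γ : Config E | ∀ n, γ.1 (B n) < ∞} := by
    intro ω n
    rw [← Set.univ_inter (B n), hcount ω.1 ω.2 n _ MeasurableSet.univ]
    exact ENNReal.natCast_lt_top _
  have hle : ∀ q : ℚ, MeasurableSet {z | e z ≤ q} := fun q => hem measurableSet_Iic
  -- The sorted encoding is onto, and the countably many counts in `{e ≤ q} ∩ B n`, with `q`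
  -- rational, recover it.
  refine standardBorelSpace_of_bijective (X := X) (T := ℕ × ℚ → ℝ≥0∞)
    (g := fun ω => ⟨superpose ω.1, hmem ω⟩)
    (φ := fun γ p => γ.1.1 ({z | e z ≤ p.2} ∩ B p.1)) ?_ ?_ ?_ ?_
  · exact (measurable_superpose.comp measurable_subtype_coe).subtype_mk
  · rintro ⟨γ, hγ⟩
    choose ω hω hωγ using fun n => exists_sortedSample e γ (hB n) (hγ n)
    refine ⟨⟨ω, hω⟩, Subtype.ext (Subtype.ext (Measure.ext fun A hA => ?_))⟩
    change (superpose ω).1 A = γ.1 A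
    rw [superpose_apply _ hA]
    simp_rw [hωγ _ A hA]
    rw [← measure_iUnion (fun i j hij => (hd hij).mono Set.inter_subset_right
      Set.inter_subset_right) fun n => hA.inter (hB n), ← Set.inter_iUnion, hU, Set.inter_univ]
  · exact measurable_pi_lambda _ fun p =>
      (measurable_eval ((hle p.2).inter (hB p.1))).comp measurable_subtype_coe
  · intro ω ω' h
    refine Subtype.ext (funext fun n => sortedSamples_ext hei (ω.2 n) (ω'.2 n) fun q => ?_)
    have h1 := congrFun h (n, q)
    change (superpose ω.1).1 ({z | e z ≤ q} ∩ B n) = (superpose ω'.1).1 ({z | e z ≤ q} ∩ B n) at h1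
    rw [hcount _ ω.2 _ _ (hle q), hcount _ ω'.2 _ _ (hle q)] at h1
    exact_mod_cast h1

/-- The disjointed spanning sets have finite `μ`-measure, so almost every configuration has finitely
many points in each of them. -/
theorem exists_polish_fullSubspace [StandardBorelSpace E] {μ : Measure E} [SigmaFinite μ]
    {π : Measure (Config E)} (h : IsPoissonMeasure μ π) :
    ∃ (S : Set (Config E)) (_ : TopologicalSpace S), IsFullSubspace π S ∧ PolishSpace S := by
  set B := disjointed (spanningSets μ) with hB
  have hBm : ∀ n, MeasurableSet (B n) := MeasurableSet.disjointed (measurableSet_spanningSets μ)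
  have hBfin : ∀ n, μ (B n) < ∞ := fun n =>
    (measure_mono (disjointed_subset _ _)).trans_lt (measure_spanningSets_lt_top μ n)
  obtain ⟨t, ht, htp⟩ := (standardBorelSpace_locallyFinite hBm (disjoint_disjointed _)
    (by rw [hB, iUnion_disjointed, iUnion_spanningSets])).polish
  refine ⟨{γ | ∀ n, γ.1 (B n) < ∞}, t, ⟨?_, ?_, ht⟩, htp⟩
  · rw [Set.ofPred_forall]
    exact MeasurableSet.iInter fun n => measurable_eval (hBm n) measurableSet_Iio
  · change ∀ᵐ γ ∂π, γ ∈ {γ : Config E | ∀ n, γ.1 (B n) < ∞}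
    filter_upwards [ae_all_iff.2 fun n => h.ae_count (hBm n) (hBfin n)] with γ hγ n
    obtain ⟨k, hk⟩ := hγ n
    rw [← hk]
    exact ENNReal.natCast_lt_top k

end SortedSamples

end ConfigSpace

theorem proposition3p4 {E : Type*} [TopologicalSpace E] [PolishSpace E] [MeasurableSpace E]
    [BorelSpace E] (μ : Measure E) [SigmaFinite μ] :
    -- up to a null set, the configuration space is Polish
    (∃ (S : Set (ConfigSpace.Config E)) (_ : TopologicalSpace S),
      ConfigSpace.IsFullSubspace (ConfigSpace.poissonMeasure μ) S ∧ PolishSpace S) ∧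
    -- in every such Polish space the union of suitable compact sets is a locally compact space
    (∀ (S : Set (ConfigSpace.Config E)) (_ : TopologicalSpace S),
      ConfigSpace.IsFullSubspace (ConfigSpace.poissonMeasure μ) S → PolishSpace S →
      ∃ (K : ℕ → Set (ConfigSpace.Config E)) (hK : ∀ n, K n ⊆ S), Monotone K ∧
        (∀ n, IsCompact (Subtype.val ⁻¹' K n : Set S)) ∧
        (∀ n, ConfigSpace.poissonMeasure μ (K n)ᶜ ≤ 1 / ((n : ℝ≥0∞) + 1)) ∧
        ∃ _ : TopologicalSpace (⋃ n, K n : Set (ConfigSpace.Config E)),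
          ConfigSpace.IsFullSubspace (ConfigSpace.poissonMeasure μ) (⋃ n, K n) ∧
          LocallyCompactSpace (⋃ n, K n : Set (ConfigSpace.Config E)) ∧
          TopologicalSpace.SeparableSpace (⋃ n, K n : Set (ConfigSpace.Config E)) ∧
          TopologicalSpace.MetrizableSpace (⋃ n, K n : Set (ConfigSpace.Config E)) ∧
          (ConfigSpace.restr (ConfigSpace.poissonMeasure μ) (⋃ n, K n)).IsOpenPosMeasure ∧
          (∀ n, IsCompact (Subtype.val ⁻¹' K n : Set (⋃ n, K n : Set (ConfigSpace.Config E)))) ∧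
          Continuous (Set.inclusion (Set.iUnion_subset hK))) ∧
    -- on every such locally compact space the form is a regular Dirichlet form
    ∀ ψ : ConfigSpace.Config E × E → ℝ, Measurable ψ → (∀ p, 0 ≤ ψ p) →
      Integrable ψ ((ConfigSpace.poissonMeasure μ).prod μ) →
      ∀ (S : Set (ConfigSpace.Config E)) (_ : TopologicalSpace S) (_ : LocallyCompactSpace S)
        (_ : TopologicalSpace.SeparableSpace S) (_ : TopologicalSpace.MetrizableSpace S)
        (hS : ConfigSpace.IsFullSubspace (ConfigSpace.poissonMeasure μ) S),
        haveI := hS.borelSpace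
        ConfigSpace.IsRegularDirichletForm (ConfigSpace.restr (ConfigSpace.poissonMeasure μ) S)
          (ConfigSpace.birthDomain μ ψ S) (ConfigSpace.birthForm μ ψ S) := by
  refine ⟨ConfigSpace.exists_polish_fullSubspace (ConfigSpace.isPoissonMeasure_poissonMeasure μ),
    fun S _ hS _ => ConfigSpace.exists_locallyCompact_fullSubspace hS
      (fun n => by simp) ?_, fun ψ hψ hψ0 hψi S _ _ _ _ hS => ?_⟩
  -- The compact sets are numbered from `0`, hence the bound `1 / (n + 1)`.
  · simp_rw [one_div]
    exact ENNReal.tendsto_inv_nat_nhds_zero.comp (Filter.tendsto_add_atTop_nat 1) |>.congr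
      fun n => by simp
  · have := hS.borelSpace
    exact ConfigSpace.isRegularDirichletForm_birthForm hψ hψ0 hψi hS.measurableSet hS.measure_compl
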